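/- There is a universal constant $C>0$ such that the following holds. Let $g:\mathbb R^d\to\mathbb R$ be twice differentiable with $g_\star=\inf g>-\infty$, with $\beta$-Lipschitz gradient and $2\rho$-Lipschitz Hessian in operator norm ($\beta,\rho>0$). Let $y_0\in\mathbb R^d$, $\delta\in(0,1]$ and $0<\epsilon\le\min\{\beta^2/\rho,\ \rho^{1/3}(g(y_0)-g_\star)^{2/3}\}$. Put $r=\sqrt{\epsilon/(9\rho)}$ and write $\mathcal K_t[A,S]=\mathrm{span}\{A^jv: 0\le j<t,\ v\in S\}$. Consider the following randomized method. For $k=1,2,\dots$: let $A=\nabla^2 g(y_{k-1})$, $b=\nabla g(y_{k-1})$, $\delta_k=\delta/(2k^2)$; call Solve-CR, that is, draw $u_k$ uniformly from the unit sphere, independently of $y_0,\dots,y_{k-1}$, and let $\Delta_k$ be any (measurably chosen) minimizer of $\frac12x^TAx+b^Tx+\frac\rho3\|x\|^3$ over $\mathcal K_{T_k}[A,\{b,u_k\}]$ with $$T_k=\Big\lceil\sqrt{\tfrac{24\beta}{\rho r}\big(4+\tfrac12\log^2\tfrac{4d}{\delta_k^2}\big)}\Big\rceil ;$$ set $y_k=y_{k-1}+\Delta_k$.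 If $g(y_k)>g(y_{k-1})-\frac1{12}\rho r^3$, stop and return $y_{k-1}+\Delta_{\mathrm{final}}$, where $\Delta_{\mathrm{final}}$ is a minimizer of $\frac12x^TAx+b^Tx+\rho r\|x\|^2$ over $\mathcal K_{T_{\mathrm{fin}}}[A,\{b\}]$ with $\epsilon_g=\frac23\epsilon$ and $$T_{\mathrm{fin}}=\Big\lceil\tfrac14\sqrt{\tfrac{\beta+2\rho r}{\rho r}}\,\log\tfrac{36(\beta+2\rho r)^2r^2}{\epsilon_g^2}\Big\rceil .$$ Then with probability at least $1-\delta$ the method stops, $\Delta_{\mathrm{final}}$ exists, and (for every choice of it) the returned point $y_\epsilon$ is an $\epsilon$-second-order stationary point, $\|\nabla g(y_\epsilon)\|\le\epsilon$ and $\nabla^2g(y_\epsilon)\succeq-\sqrt{\rho\epsilon}\,I$, after at most $$C\,\frac{\beta^{1/2}\rho^{1/4}(g(y_0)-g_\star)}{\epsilon^{7/4}}\Big[1+\log\frac d{\delta^2}+\log\frac{\beta^{1/2}\rho^{1/4}(g(y_0)-g_\star)}{\epsilon^{7/4}}\Big]$$ Hessian-vector product evaluations, at most $C\sqrt\rho\,(g(y_0)-g_\star)\,\epsilon^{-3/2}$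 calls to Solve-CR and at most $C\sqrt\rho\,(g(y_0)-g_\star)\,\epsilon^{-3/2}$ gradient evaluations. Here the data needed for a minimization over $\mathcal K_t[A,S]$ are obtained by computing $A^jv$, $1\le j\le t$, $v\in S$, one Hessian-vector product each, and $\nabla g(y_{k-1})$ is evaluated once in iteration $k$. -/

import Mathlib

open MeasureTheory ProbabilityTheory
open scoped Gradient

noncomputable section

/-! ### The class of objectives and approximate second-order stationarity -/

/-- The Hessian `∇²g(y)` as a linear operator: the derivative of the gradient. -/
def hessian {d : ℕ} (g : EuclideanSpace ℝ (Fin d) → ℝ) (y : EuclideanSpace ℝ (Fin d)) :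
    EuclideanSpace ℝ (Fin d) →L[ℝ] EuclideanSpace ℝ (Fin d) :=
  fderiv ℝ (∇ g) y

/-- `g` is twice differentiable, bounded below, `β`-smooth and has `2ρ`-Lipschitz Hessian
(operator norm). -/
structure SmoothObjective {d : ℕ} (g : EuclideanSpace ℝ (Fin d) → ℝ) (β ρ : ℝ) : Prop where
  bddBelow : BddBelow (Set.range g)
  differentiable : Differentiable ℝ g
  differentiable_gradient : Differentiable ℝ (∇ g)
  smooth : ∀ x y, ‖∇ g x - ∇ g y‖ ≤ β * ‖x - y‖
  hessian_lipschitz : ∀ x y, ‖hessian g x - hessian g y‖ ≤ 2 * ρ * ‖x - y‖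

/-- `‖∇g(y)‖ ≤ ε` and `∇²g(y) ⪰ -√(ρε) I` (Loewner order). -/
def IsSecondOrderStationary {d : ℕ} (g : EuclideanSpace ℝ (Fin d) → ℝ) (ρ ε : ℝ)
    (y : EuclideanSpace ℝ (Fin d)) : Prop :=
  ‖∇ g y‖ ≤ ε ∧
    -(Real.sqrt (ρ * ε) • ContinuousLinearMap.id ℝ (EuclideanSpace ℝ (Fin d))) ≤ hessian g y

/-! ### Krylov subspaces, regularized models and the two subproblem solvers -/

/-- The (joint) Krylov subspace of order `t`: the span of `A ^ j v`, `j < t`, `v ∈ S`.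
For `S = {b}` it is `K_t(A, b)`, for `S = {b, u}` the joint subspace `K_t(A, {b, u})`. -/
def krylov {d : ℕ}
    (t : ℕ) (A : EuclideanSpace ℝ (Fin d) →L[ℝ] EuclideanSpace ℝ (Fin d))
    (S : Set (EuclideanSpace ℝ (Fin d))) : Submodule ℝ (EuclideanSpace ℝ (Fin d)) :=
  Submodule.span ℝ {x | ∃ j < t, ∃ v ∈ S, x = (A ^ j) v}

/-- `½ xᵀAx + bᵀx`. -/
def quadModel {d : ℕ} (A : EuclideanSpace ℝ (Fin d) →L[ℝ] EuclideanSpace ℝ (Fin d))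
    (b x : EuclideanSpace ℝ (Fin d)) : ℝ :=
  1 / 2 * inner ℝ x (A x) + inner ℝ b x

/-- `½ xᵀAx + bᵀx + (ρ/3)‖x‖³`. -/
def cubicModel {d : ℕ} (A : EuclideanSpace ℝ (Fin d) →L[ℝ] EuclideanSpace ℝ (Fin d))
    (b : EuclideanSpace ℝ (Fin d)) (ρ : ℝ) (x : EuclideanSpace ℝ (Fin d)) : ℝ :=
  quadModel A b x + ρ / 3 * ‖x‖ ^ 3

/-- The set of minimizers of `f` over `V`. -/
def argminOn {d : ℕ} (f : EuclideanSpace ℝ (Fin d) → ℝ)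
    (V : Submodule ℝ (EuclideanSpace ℝ (Fin d))) : Set (EuclideanSpace ℝ (Fin d)) :=
  {x | x ∈ V ∧ ∀ z ∈ V, f x ≤ f z}

/-- `T_inner = ⌈√( (24β/(ρr)) (4 + ½ log²(4d/δ²)) )⌉`. -/
def innerSteps (d : ℕ) (ρ β r δ : ℝ) : ℕ :=
  ⌈Real.sqrt (24 * β / (ρ * r) * (4 + 1 / 2 * Real.log (4 * d / δ ^ 2) ^ 2))⌉₊

/-- `T_fin = ⌈¼ √((β+2ρr)/(ρr)) log(36 (β+2ρr)² r² / ε_g²)⌉`. -/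
def finalSteps (ρ β r εg : ℝ) : ℕ :=
  ⌈1 / 4 * Real.sqrt ((β + 2 * ρ * r) / (ρ * r)) *
    Real.log (36 * (β + 2 * ρ * r) ^ 2 * r ^ 2 / εg ^ 2)⌉₊

/-- Possible return values of Solve-CR when the random direction drawn is `u`: all minimizers of
the cubic model over the joint Krylov subspace of order `T_inner`. -/
def solveCR {d : ℕ} (A : EuclideanSpace ℝ (Fin d) →L[ℝ] EuclideanSpace ℝ (Fin d))
    (b : EuclideanSpace ℝ (Fin d)) (ρ β r δ : ℝ) (u : EuclideanSpace ℝ (Fin d)) :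
    Set (EuclideanSpace ℝ (Fin d)) :=
  argminOn (cubicModel A b ρ) (krylov (innerSteps d ρ β r δ) A {b, u})

/-- Possible return values of Solve-Quadratic: all minimizers of `½ xᵀAx + bᵀx + ρr‖x‖²` over the
Krylov subspace of order `T_fin`. -/
def solveQuadratic {d : ℕ} (A : EuclideanSpace ℝ (Fin d) →L[ℝ] EuclideanSpace ℝ (Fin d))
    (b : EuclideanSpace ℝ (Fin d)) (ρ β r εg : ℝ) : Set (EuclideanSpace ℝ (Fin d)) :=
  argminOn (fun x => quadModel A b x + ρ * r * ‖x‖ ^ 2) (krylov (finalSteps ρ β r εg) A {b})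

/-! ### The majorization method -/

/-- `r = √(ε/(9ρ))`. -/
def stepRadius (ρ ε : ℝ) : ℝ := Real.sqrt (ε / (9 * ρ))

/-- The confidence parameter of the call to Solve-CR leading from `y_k` to `y_{k+1}` (call number
`k + 1`): `δ / (2 (k+1)²)`. -/
def callConfidence (δ : ℝ) (k : ℕ) : ℝ := δ / (2 * ((k : ℝ) + 1) ^ 2)

/-- The step from `y` to `y'` decreases `g` by at least `ρ r³ / 12`. -/
def MakesProgress {d : ℕ} (g : EuclideanSpace ℝ (Fin d) → ℝ) (ρ ε : ℝ)
    (y y' : EuclideanSpace ℝ (Fin d)) : Prop :=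
  g y' ≤ g y - 1 / 12 * ρ * stepRadius ρ ε ^ 3

/-- The uniform probability distribution on the unit sphere of `ℝᵈ`. -/
def uniformSphere (d : ℕ) : Measure (Metric.sphere (0 : EuclideanSpace ℝ (Fin d)) 1) :=
  ((volume : Measure (EuclideanSpace ℝ (Fin d))).toSphere Set.univ)⁻¹ •
    (volume : Measure (EuclideanSpace ℝ (Fin d))).toSphere

/-- `y` is the random sequence of iterates of the method started at `y₀`, and `U k` is the
direction drawn in the call to Solve-CR that leads from `y k` to `y (k+1)`: uniform on the sphere
and independent of all iterates computed before. As long as every earlier step made progress, the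
next step is a minimizer returned by Solve-CR (ties may be broken in any measurable way); what
`y` is after the method has stopped is irrelevant. -/
structure IsMajorizationRun {d : ℕ} {Ω : Type*} [MeasurableSpace Ω] (P : Measure Ω)
    (g : EuclideanSpace ℝ (Fin d) → ℝ) (β ρ ε δ : ℝ) (y₀ : EuclideanSpace ℝ (Fin d))
    (U : ℕ → Ω → Metric.sphere (0 : EuclideanSpace ℝ (Fin d)) 1)
    (y : ℕ → Ω → EuclideanSpace ℝ (Fin d)) : Prop where
  measurable : ∀ k, Measurable (y k)
  init : ∀ ω, y 0 ω = y₀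
  uniform : ∀ k, HasLaw (U k) (uniformSphere d) P
  fresh : ∀ k, IndepFun (fun ω (i : Fin (k + 1)) => y i ω) (U k) P
  step : ∀ k ω, (∀ j < k, MakesProgress g ρ ε (y j ω) (y (j + 1) ω)) →
    ∃ Δ ∈ solveCR (hessian g (y k ω)) (∇ g (y k ω)) ρ β (stepRadius ρ ε) (callConfidence δ k)
      (U k ω), y (k + 1) ω = y k ω + Δ

/-- The first step without sufficient progress is the one from `y k` to `y (k+1)`, so the method
makes exactly `k + 1` iterations. -/
def StopsAt {d : ℕ} (g : EuclideanSpace ℝ (Fin d) → ℝ) (ρ ε : ℝ)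
    (y : ℕ → EuclideanSpace ℝ (Fin d)) (k : ℕ) : Prop :=
  (∀ j < k, MakesProgress g ρ ε (y j) (y (j + 1))) ∧ ¬ MakesProgress g ρ ε (y k) (y (k + 1))

/-- The points that the method may return when it stops with last successful iterate `y`:
`y + Δ_final` with `Δ_final` a solution returned by Solve-Quadratic, `ε_g = 2ε/3`. -/
def finalPoints {d : ℕ} (g : EuclideanSpace ℝ (Fin d) → ℝ) (β ρ ε : ℝ)
    (y : EuclideanSpace ℝ (Fin d)) : Set (EuclideanSpace ℝ (Fin d)) :=
  {z | ∃ Δ ∈ solveQuadratic (hessian g y) (∇ g y) ρ β (stepRadius ρ ε) (2 * ε / 3), z = y + Δ}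

/-! ### Counting gradient and Hessian-vector product evaluations -/

/-- A query to the first-order oracle: the gradient at `y`, or the product `∇²g(y) v`. -/
inductive OracleQuery (E : Type*) where
  | grad (y : E)
  | hvp (y v : E)

/-- An adaptive computation that has access to the objective only through oracle queries, each
of which is answered by a vector. -/
inductive OracleProg (E : Type*) (α : Type*) where
  | done (a : α)
  | ask (q : OracleQuery E) (next : E → OracleProg E α)

namespace OracleProg

variable {E : Type*} {α γ : Type*}

/-- Sequential composition. -/
def bind : OracleProg E α → (α → OracleProg E γ) → OracleProg E γ
  | done a, f => f a
  | ask q next, f => ask q (fun w => (next w).bind f)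

/-- The result of the computation when queries are answered by `ans`. -/
def result (ans : OracleQuery E → E) : OracleProg E α → α
  | done a => a
  | ask q next => (next (ans q)).result ans

/-- The number of gradient queries made when queries are answered by `ans`. -/
def gradCount (ans : OracleQuery E → E) : OracleProg E α → ℕ
  | done _ => 0
  | ask (.grad y) next => (next (ans (.grad y))).gradCount ans + 1
  | ask (.hvp y v) next => (next (ans (.hvp y v))).gradCount ans

/-- The number of Hessian-vector product queries made when queries are answered by `ans`. -/
def hvpCount (ans : OracleQuery E → E) : OracleProg E α → ℕ
  | done _ => 0
  | ask (.grad y) next => (next (ans (.grad y))).hvpCount ans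
  | ask (.hvp y v) next => (next (ans (.hvp y v))).hvpCount ans + 1

theorem result_bind (ans : OracleQuery E → E) (p : OracleProg E α) (f : α → OracleProg E γ) :
    (p.bind f).result ans = (f (p.result ans)).result ans := by
  induction p with
  | done a => rfl
  | ask q next ih => exact ih _

end OracleProg

/-- The power sequence of Hessian-vector products at `y` from `v`: it returns the list of the pairs
`(A ^ j v, A ^ (j+1) v)`, `j < t`, with `A = ∇²g(y)`, i.e. spanning vectors of the Krylov subspace
together with their images under `A`. These determine the restriction of every model
`½ xᵀAx + bᵀx + reg ‖x‖` to the subspace, so that minimizing it needs no further query. -/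
def krylovProg {E : Type*} (y : E) : ℕ → E → OracleProg E (List (E × E))
  | 0, _ => .done []
  | t + 1, v => .ask (.hvp y v) fun w => (krylovProg y t w).bind fun L => .done ((v, w) :: L)

/-- The oracle queries of Solve-CR at `y` with gradient `b`, direction `u` and order `T`. -/
def solveCRProg {E : Type*} (y : E) (T : ℕ) (b u : E) : OracleProg E (List (E × E)) :=
  (krylovProg y T b).bind fun L => (krylovProg y T u).bind fun L' => .done (L ++ L')

/-- The oracle queries of iterations `1, …, k + 1` of the method with iterates `y`, drawn
directions `u` and orders `T`: each one evaluates the gradient and calls Solve-CR. The last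
gradient is kept. -/
def iterationsProg {E : Type*} (y u : ℕ → E) (T : ℕ → ℕ) : ℕ → OracleProg E E
  | 0 => .ask (.grad (y 0)) fun b => (solveCRProg (y 0) (T 0) b (u 0)).bind fun _ => .done b
  | k + 1 => (iterationsProg y u T k).bind fun _ => .ask (.grad (y (k + 1))) fun b =>
      (solveCRProg (y (k + 1)) (T (k + 1)) b (u (k + 1))).bind fun _ => .done b

/-- The oracle queries of a whole execution with `k + 1` iterations, including those of the
final call to Solve-Quadratic. -/
def executionProg {E : Type*} (y u : ℕ → E) (T : ℕ → ℕ) (Tfin k : ℕ) :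
    OracleProg E (List (E × E)) :=
  (iterationsProg y u T k).bind fun b => krylovProg (y k) Tfin b

/-- The oracle of the objective `g`. -/
def oracleOf {d : ℕ} (g : EuclideanSpace ℝ (Fin d) → ℝ) :
    OracleQuery (EuclideanSpace ℝ (Fin d)) → EuclideanSpace ℝ (Fin d)
  | .grad y => ∇ g y
  | .hvp y v => hessian g y v

/-- The list of vectors that `krylovProg` returns. -/
theorem krylovProg_result {d : ℕ} (g : EuclideanSpace ℝ (Fin d) → ℝ)
    (y : EuclideanSpace ℝ (Fin d)) (t : ℕ) (v : EuclideanSpace ℝ (Fin d)) :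
    (krylovProg y t v).result (oracleOf g) =
      (List.range t).map fun j => ((hessian g y ^ j) v, (hessian g y ^ (j + 1)) v) := by
  induction t generalizing v with
  | zero => rfl
  | succ t ih =>
    rw [List.range_succ_eq_map, List.map_cons, List.map_map]
    simp only [krylovProg, OracleProg.result, OracleProg.result_bind, ih]
    simp [oracleOf, pow_succ, Function.comp_def]

/-- The vectors queried by Solve-CR span the joint Krylov subspace. -/
theorem span_solveCRProg {d : ℕ} (g : EuclideanSpace ℝ (Fin d) → ℝ)
    (y : EuclideanSpace ℝ (Fin d)) (T : ℕ) (b u : EuclideanSpace ℝ (Fin d)) :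
    Submodule.span ℝ {x | ∃ w, (x, w) ∈ (solveCRProg y T b u).result (oracleOf g)} =
      krylov T (hessian g y) {b, u} := by
  unfold krylov
  congr 1
  ext x
  have h : (solveCRProg y T b u).result (oracleOf g) =
      ((List.range T).map fun j => ((hessian g y ^ j) b, (hessian g y ^ (j + 1)) b)) ++
        ((List.range T).map fun j => ((hessian g y ^ j) u, (hessian g y ^ (j + 1)) u)) := by
    simp only [solveCRProg, OracleProg.result, OracleProg.result_bind, krylovProg_result]
  constructor
  · rintro ⟨w, hw⟩
    rw [h, List.mem_append, List.mem_map, List.mem_map] at hw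
    rcases hw with ⟨j, hj, he⟩ | ⟨j, hj, he⟩
    · exact ⟨j, List.mem_range.1 hj, b, Or.inl rfl, (congrArg Prod.fst he).symm⟩
    · exact ⟨j, List.mem_range.1 hj, u, Or.inr rfl, (congrArg Prod.fst he).symm⟩
  · rintro ⟨j, hj, v, rfl | rfl, rfl⟩
    · refine ⟨(hessian g y ^ (j + 1)) v, ?_⟩
      rw [h, List.mem_append]
      exact Or.inl (List.mem_map.2 ⟨j, List.mem_range.2 hj, rfl⟩)
    · refine ⟨(hessian g y ^ (j + 1)) v, ?_⟩
      rw [h, List.mem_append]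
      exact Or.inr (List.mem_map.2 ⟨j, List.mem_range.2 hj, rfl⟩)

/-- Number of gradient evaluations of an execution with iterates `y`, directions `u` and
`k + 1` iterations. -/
def gradEvals {d : ℕ} (g : EuclideanSpace ℝ (Fin d) → ℝ) (β ρ ε δ : ℝ)
    (y u : ℕ → EuclideanSpace ℝ (Fin d)) (k : ℕ) : ℕ :=
  (executionProg y u (fun j => innerSteps d ρ β (stepRadius ρ ε) (callConfidence δ j))
    (finalSteps ρ β (stepRadius ρ ε) (2 * ε / 3)) k).gradCount (oracleOf g)

/-- Number of Hessian-vector product evaluations of an execution with iterates `y`, directions `u`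
and `k + 1` iterations. -/
def hvpEvals {d : ℕ} (g : EuclideanSpace ℝ (Fin d) → ℝ) (β ρ ε δ : ℝ)
    (y u : ℕ → EuclideanSpace ℝ (Fin d)) (k : ℕ) : ℕ :=
  (executionProg y u (fun j => innerSteps d ρ β (stepRadius ρ ε) (callConfidence δ j))
    (finalSteps ρ β (stepRadius ρ ε) (2 * ε / 3)) k).hvpCount (oracleOf g)

end

/-! Since the Hessian is `2ρ`-Lipschitz, the cubic model majorizes the change of `g`
(`le_add_cubicModel`). A step that fails to make progress therefore certifies that the model has no
value below `-ρr³/12` on the joint Krylov space. The proof shows that, outside a small exceptional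
set of directions `u`, this certificate forces the final quadratic step to succeed.

Let `A` be the Hessian, `b` the gradient and `s = -(A + ρr)⁻¹ b`. There are three cases
(`low_cubicModel_or_solveQuadratic`). If some eigenvalue of `A` is at most `-(9/10)ρr` and `u` has a
non-negligible component along its eigenvector, a Chebyshev-type polynomial in `A` turns `u` into a
direction of curvature below `-(4/5)ρr`. Moving along it makes the model low
(`exists_krylov_curvature_lt`, `exists_smul_cubicModel_lt`). If all eigenvalues exceed `-(9/10)ρr`
but `‖s‖ > r`, then `s` is approximated inside the Krylov space of `b`, and rescaling the
approximation to length about `r` again gives a low value (`exists_krylov_cubicModel_lt`). Otherwise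
`A + 2ρr` is well conditioned and its exact solution has norm at most `r`. Conjugate gradient
iterates are never longer than the exact solution and have a small residual
(`argminOn_krylov_bounds`). Taylor expansion then gives second-order stationarity
(`isSecondOrderStationary_add`).

Randomness enters only in the first case. A coordinate of a uniform unit vector is small with small
probability (`uniformSphere_inner_sq_lt_le`), freshness of the direction transfers this to the
random iterate (`prob_mem_unluckyPairs_le`), and the confidences sum to at most `δ`.

For the complexity, every successful step lowers `g` by `ρr³/12`, which bounds the number of
iterations, and each iteration costs twice the Krylov order. In terms of `S = √(β/√(ρε))` and `N =
√ρ (g(y₀) - g⋆) ε^(-3/2)`, both at least 1 by the assumption on `ε`, the leading quantity of the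
Hessian-vector bound is `N·S`. -/

noncomputable section

/-! ### Chebyshev estimates and residual polynomials -/

open Polynomial in
-- Beyond 1, `T_m` is `cosh (m · arcosh y)`, which increases with `y`. This exponential growth
-- outside `[-1, 1]` drives every convergence rate below.
theorem cosh_mul_le_eval_chebyshevT (m : ℕ) {φ y : ℝ} (hφ : 0 ≤ φ) (h : Real.cosh φ ≤ y) :
    Real.cosh (m * φ) ≤ (Chebyshev.T ℝ m).eval y := by
  have hy : 1 ≤ y := (Real.one_le_cosh φ).trans h
  have hθ : Real.cosh (Real.arcosh y) = y := Real.cosh_arcosh hy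
  have h0 : 0 ≤ Real.arcosh y := Real.arcosh_nonneg hy
  rw [← hθ, Chebyshev.T_real_cosh]
  rw [← hθ, Real.cosh_le_cosh, abs_of_nonneg hφ, abs_of_nonneg h0] at h
  rw [Real.cosh_le_cosh]
  push_cast
  rw [abs_of_nonneg (by positivity), abs_of_nonneg (by positivity)]
  gcongr

open Polynomial in
/-- Chebyshev polynomials of the third kind are square roots of `(1 + T_{2n+1}) / (1 + X)`. -/
theorem one_add_X_mul_chebyshevU_sub_sq (n : ℤ) :
    (1 + X) * (Chebyshev.U ℝ n - Chebyshev.U ℝ (n - 1)) ^ 2 = 1 + Chebyshev.T ℝ (2 * n + 1) := by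
  have h1 : (Chebyshev.U ℝ (n - 1)) ^ 2 + (Chebyshev.U ℝ n) ^ 2
      - 2 * X * Chebyshev.U ℝ (n - 1) * Chebyshev.U ℝ n = 1 := by
    have := congrArg (fun p => p.comp (2 * X)) (Chebyshev.S_sq_add_S_sq ℝ (n - 1))
    simpa [Chebyshev.S_comp_two_mul_X] using this
  have h2 := Chebyshev.T_eq_U_sub_X_mul_U ℝ n
  have h3 : Chebyshev.T ℝ (n + 1) = X * Chebyshev.U ℝ n - Chebyshev.U ℝ (n - 1) := by
    have := Chebyshev.T_eq_X_mul_U_sub_U ℝ (n - 1)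
    rwa [show n - 1 + 2 = n + 1 by ring, show n - 1 + 1 = n by ring] at this
  have h4 := Chebyshev.T_mul_T ℝ n (n + 1)
  rw [show n + (n + 1) = 2 * n + 1 by ring, show n - (n + 1) = -1 by ring,
    Chebyshev.T_neg_one] at h4
  rw [← sub_eq_zero] at h4 ⊢
  rw [h2, h3] at h4
  linear_combination h4 + (1 - X) * h1

open Polynomial in
theorem degree_chebyshevU_sub_le (n : ℕ) :
    (Chebyshev.U ℝ n - Chebyshev.U ℝ ((n : ℤ) - 1)).natDegree ≤ n := by
  refine (natDegree_sub_le _ _).trans ?_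
  rw [Chebyshev.natDegree_U_natCast, Chebyshev.natDegree_U]
  simp

/-- This is `tanh a ≤ a` combined with `cosh 2a = (1 + tanh² a) / (1 - tanh² a)`. For `a² = μ/L` the
right side is `(L + μ)/(L - μ)`, the image of 0 under the decreasing affine map of `[μ, L]` onto
`[-1, 1]`. -/
theorem cosh_two_mul_le {a : ℝ} (h0 : 0 ≤ a) (h1 : a < 1) :
    Real.cosh (2 * a) ≤ (1 + a ^ 2) / (1 - a ^ 2) := by
  have hs : Real.sinh a ≤ a * Real.cosh a := by
    have hmono : MonotoneOn (fun x => x * Real.cosh x - Real.sinh x) (Set.Ici 0) := by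
      apply monotoneOn_of_deriv_nonneg (convex_Ici 0)
      · fun_prop
      · fun_prop
      · intro x hx
        simp only [interior_Ici, Set.mem_Ioi] at hx
        have : deriv (fun x => x * Real.cosh x - Real.sinh x) x = x * Real.sinh x := by
          have := ((hasDerivAt_id x).mul (Real.hasDerivAt_cosh x)).sub (Real.hasDerivAt_sinh x)
          exact this.deriv.trans (by simp)
        rw [this]
        exact mul_nonneg hx.le (Real.sinh_nonneg_iff.2 hx.le)
    have := hmono (Set.mem_Ici.2 le_rfl) (Set.mem_Ici.2 h0) h0
    simp at this
    linarith
  have hc := Real.cosh_pos a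
  have hsn := Real.sinh_nonneg_iff.2 h0
  have hsq : Real.sinh a ^ 2 ≤ a ^ 2 * Real.cosh a ^ 2 := by
    rw [← mul_pow]; gcongr
  have hid := Real.cosh_sq a
  rw [Real.cosh_two_mul, le_div_iff₀ (by nlinarith)]
  nlinarith

open Polynomial in
/-- A polynomial of degree less than `t` that approximates `1 / x` on `[μ, L]`. -/
theorem exists_approx_inv {μ L : ℝ} (hμ : 0 < μ) (hL : μ < L) (t : ℕ) :
    ∃ p : ℝ[X], p.degree < t ∧
      ∀ x ∈ Set.Icc μ L, |1 - x * p.eval x| ≤ 1 / Real.cosh (t * (2 * Real.sqrt (μ / L))) := by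
  set ℓ : ℝ[X] := C (-2 / (L - μ)) * X + C ((L + μ) / (L - μ)) with hℓ
  have hd : 0 < L - μ := by linarith
  have hLp : 0 < L := by linarith
  set y₀ := (L + μ) / (L - μ) with hy₀
  set M := (Chebyshev.T ℝ t).eval y₀ with hM
  have hMc : Real.cosh (t * (2 * Real.sqrt (μ / L))) ≤ M := by
    apply cosh_mul_le_eval_chebyshevT t (by positivity)
    refine (cosh_two_mul_le (Real.sqrt_nonneg _) ?_).trans_eq ?_
    · rw [Real.sqrt_lt' one_pos, div_lt_iff₀ hLp]; linarith
    · rw [Real.sq_sqrt (by positivity), hy₀]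
      field_simp
  have hcpos := Real.cosh_pos (t * (2 * Real.sqrt (μ / L)))
  have hMpos : 0 < M := hcpos.trans_le hMc
  -- The classical residual polynomial, normalized to `q(0) = 1`, so that `1 - q` is divisible by
  -- `X`. The quotient is the approximation of `1/x`, with error exactly `q`.
  set q : ℝ[X] := C (1 / M) * (Chebyshev.T ℝ t).comp ℓ with hq
  have hq0 : (1 - q).coeff 0 = 0 := by
    rw [coeff_zero_eq_eval_zero]
    simp [hq, hℓ, hMpos.ne', ← hM]
  have hX : X * divX (1 - q) = 1 - q := by
    have := X_mul_divX_add (1 - q)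
    rwa [hq0, C_0, add_zero] at this
  refine ⟨divX (1 - q), ?_, fun x hx => ?_⟩
  -- For `t = 0` the degree bound leaves only the zero polynomial, which is what `T_0 = 1` gives.
  · rcases Nat.eq_zero_or_pos t with rfl | ht
    · have : (1 - q) = 0 := by simp [hq, hM]
      simp [this]
    · have hℓd : ℓ.natDegree ≤ 1 := natDegree_linear_le
      have h1 : (1 - q).natDegree ≤ t := by
        refine (natDegree_sub_le _ _).trans (max_le (by simp) ?_)
        refine (natDegree_C_mul_le _ _).trans (natDegree_comp_le.trans ?_)
        rw [Chebyshev.natDegree_T]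
        simpa using Nat.mul_le_mul_left t hℓd
      refine lt_of_le_of_lt degree_le_natDegree ?_
      rw [natDegree_divX_eq_natDegree_tsub_one]
      exact_mod_cast (by omega : (1 - q).natDegree - 1 < t)
  · have h1 : 1 - x * (divX (1 - q)).eval x = q.eval x := by
      have := congrArg (eval x) hX
      simp only [eval_mul, eval_X, eval_sub, eval_one] at this
      linarith
    rw [h1, hq]
    have hyx : |ℓ.eval x| ≤ 1 := by
      simp only [hℓ, eval_add, eval_mul, eval_C, eval_X]
      rw [hy₀, div_mul_eq_mul_div, ← add_div, abs_div, abs_of_pos hd, div_le_one hd, abs_le]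
      constructor <;> linarith [hx.1, hx.2]
    rw [eval_mul, eval_C, eval_comp, abs_mul, abs_of_pos (by positivity)]
    have := Chebyshev.abs_eval_T_real_le_one t hyx
    calc 1 / M * |eval (eval x ℓ) (Chebyshev.T ℝ t)| ≤ 1 / M * 1 := by gcongr
      _ ≤ _ := by rw [mul_one]; gcongr

open Polynomial in
-- Split off positive roots one at a time as factors `1 - X/θ`; each contributes `-1/θ` to `q'/q` at
-- 0. If a constant remains, the derivative at 0 is nonpositive. Otherwise the remaining nonconstant
-- factor has no positive root and is positive on the positive axis. This replaces the fact that
-- conjugate gradient residual polynomials have only positive roots, and also covers early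
-- termination.
theorem derivative_nonpos_or_eq_mul {q : ℝ[X]} (hq : 0 < q.eval 0) :
    q.derivative.eval 0 ≤ 0 ∨
      ∃ g s : ℝ[X], q = g * s ∧ (∀ x, 0 < x → 0 < g.eval x) ∧ s.degree < q.degree := by
  induction hn : q.natDegree using Nat.strong_induction_on generalizing q with
  | _ n ih =>
  by_cases hroot : ∃ θ, 0 < θ ∧ q.eval θ = 0
  · obtain ⟨θ, hθ, hr⟩ := hroot
    have hq0 : q ≠ 0 := by rintro rfl; simp at hq
    obtain ⟨s, hs⟩ := dvd_iff_isRoot.2 hr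
    have hs' : q = (1 - C (1 / θ) * X) * (C (-θ) * s) := by
      rw [hs, ← mul_assoc]; congr 1
      rw [sub_mul, one_mul, mul_right_comm, ← C_mul]
      simp [hθ.ne']; ring
    generalize hr' : C (-θ) * s = r at hs'
    have hr0 : r ≠ 0 := by rintro rfl; simp at hs'; exact hq0 hs'
    have hlin : (1 - C (1 / θ) * X : ℝ[X]).natDegree = 1 := by
      rw [natDegree_sub_eq_right_of_natDegree_lt]
      · exact natDegree_C_mul_X _ (by positivity)
      · rw [natDegree_C_mul_X _ (by positivity)]; simp
    have hlin0 : (1 - C (1 / θ) * X : ℝ[X]) ≠ 0 := by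
      intro h; rw [h] at hlin; simp at hlin
    have hdeg : q.natDegree = 1 + r.natDegree := by
      rw [hs', natDegree_mul hlin0 hr0, hlin]
    have hr1 : r.eval 0 = q.eval 0 := by rw [hs']; simp
    rcases ih r.natDegree (by omega) (hr1 ▸ hq) rfl with h | ⟨g, w, hgw, hg, hw⟩
    · left
      rw [hs']
      simp only [derivative_mul, eval_add, eval_mul]
      simp
      have : 0 ≤ θ⁻¹ * eval 0 r := by rw [hr1]; positivity
      linarith
    · right
      refine ⟨g, (1 - C (1 / θ) * X) * w, ?_, hg, ?_⟩
      · rw [hs', hgw]; ring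
      · rw [hs', degree_mul, degree_mul]
        exact WithBot.add_lt_add_left (by simpa [degree_eq_bot] using hlin0) hw
  · push Not at hroot
    rcases Nat.eq_zero_or_pos q.natDegree with h0 | h0
    · left
      rw [eq_C_of_natDegree_eq_zero h0]; simp
    · right
      refine ⟨q, 1, by simp, fun x hx => ?_, ?_⟩
      · by_contra hneg
        push Not at hneg
        obtain ⟨z, hz, hz0⟩ := intermediate_value_Icc' hx.le (q.continuous.continuousOn)
          (show (0 : ℝ) ∈ Set.Icc (q.eval x) (q.eval 0) from ⟨hneg, hq.le⟩)
        rcases hz.1.eq_or_lt with h | h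
        · rw [← h] at hz0; simp at hz0; linarith
        · exact hroot z h hz0
      · rw [degree_one]; exact natDegree_pos_iff_degree_pos.1 h0

open Polynomial in
/-- The conjugate gradient iterates do not exceed the exact solution in norm: spectral form. -/
theorem sum_sq_le_of_orthogonal {ι : Type*} (I : Finset ι) {c w : ι → ℝ} (hc : ∀ i ∈ I, 0 < c i)
    (hw : ∀ i ∈ I, 0 ≤ w i) {t : ℕ} {p : ℝ[X]} (hp : p.degree < t)
    (horth : ∀ s : ℝ[X], s.degree < t →
      ∑ i ∈ I, (1 - c i * p.eval (c i)) * (c i ^ 2 * s.eval (c i)) * w i = 0) :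
    ∑ i ∈ I, (c i * p.eval (c i)) ^ 2 * w i ≤ ∑ i ∈ I, w i := by
  set q : ℝ[X] := 1 - X * p with hq
  have hqe : ∀ x, q.eval x = 1 - x * p.eval x := fun x => by simp [hq]
  have hq0 : 0 < q.eval 0 := by simp [hq]
  have hqd : q.derivative.eval 0 = -p.eval 0 := by simp [hq]
  -- In the first case `p(0) = -q'(0) ≥ 0`. Orthogonality to multiples of `c²` reduces the cross
  -- term `∑ q(1 - q)w` to `p(0) ∑ q c w = p(0) ∑ q² c w ≥ 0`.
  rcases derivative_nonpos_or_eq_mul hq0 with h | ⟨g, s, hgs, hg, hs⟩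
  · have hp0 : 0 ≤ p.eval 0 := by linarith
    have h1 := horth p hp
    have hdivdeg : (divX p).degree < t := by
      rcases eq_or_ne p 0 with rfl | h0
      · simp
      · exact (degree_divX_lt h0).trans hp
    have h2 := horth (divX p) hdivdeg
    have hdiv : ∀ x, p.eval x = x * (divX p).eval x + p.eval 0 := fun x => by
      conv_lhs => rw [← X_mul_divX_add p]
      simp [coeff_zero_eq_eval_zero]
    have h3 : ∑ i ∈ I, q.eval (c i) * c i * w i = ∑ i ∈ I, q.eval (c i) ^ 2 * c i * w i := by
      rw [← sub_eq_zero, ← Finset.sum_sub_distrib, ← h1]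
      refine Finset.sum_congr rfl fun i _ => ?_
      rw [hqe]; ring
    have h4 : 0 ≤ ∑ i ∈ I, q.eval (c i) * c i * w i := by
      rw [h3]
      exact Finset.sum_nonneg fun i hi =>
        mul_nonneg (mul_nonneg (sq_nonneg _) (hc i hi).le) (hw i hi)
    have h5 : ∑ i ∈ I, q.eval (c i) * (1 - q.eval (c i)) * w i =
        p.eval 0 * ∑ i ∈ I, q.eval (c i) * c i * w i := by
      refine sub_eq_zero.1 (Eq.trans ?_ h2)
      rw [Finset.mul_sum, ← Finset.sum_sub_distrib]
      refine Finset.sum_congr rfl fun i _ => ?_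
      have := hdiv (c i)
      rw [hqe]
      linear_combination (1 - c i * p.eval (c i)) * c i * w i * this
    have h6 : ∑ i ∈ I, w i - ∑ i ∈ I, (c i * p.eval (c i)) ^ 2 * w i =
        2 * ∑ i ∈ I, q.eval (c i) * (1 - q.eval (c i)) * w i + ∑ i ∈ I, q.eval (c i) ^ 2 * w i := by
      rw [Finset.mul_sum, ← Finset.sum_sub_distrib, ← Finset.sum_add_distrib]
      refine Finset.sum_congr rfl fun i _ => ?_
      rw [hqe]; ring
    have h7 : 0 ≤ ∑ i ∈ I, q.eval (c i) ^ 2 * w i :=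
      Finset.sum_nonneg fun i hi => mul_nonneg (sq_nonneg _) (hw i hi)
    have h8 : 0 ≤ p.eval 0 * ∑ i ∈ I, q.eval (c i) * c i * w i := mul_nonneg hp0 h4
    linarith
  -- In the second case `s` itself is an admissible test polynomial, and `q s = g s²` has a sign.
  -- Hence `q` vanishes at every point of positive weight: the iterate is already exact there.
  · have hst : s.degree < t := by
      have hq1 : q.degree ≤ t := by
        refine (degree_sub_le _ _).trans (max_le (by simp) ?_)
        rw [degree_mul, degree_X, add_comm]
        exact Nat.WithBot.add_one_le_of_lt hp
      exact hs.trans_le hq1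
    have h1 := horth s hst
    have h2 : ∀ i ∈ I, (1 - c i * p.eval (c i)) * (c i ^ 2 * s.eval (c i)) * w i = 0 := by
      refine (Finset.sum_eq_zero_iff_of_nonneg fun i hi => ?_).1 h1
      rw [← hqe, hgs, eval_mul]
      have := hg _ (hc i hi)
      have := hw i hi
      have : 0 ≤ eval (c i) g * (c i ^ 2) * (eval (c i) s) ^ 2 * w i := by positivity
      linarith
    refine Finset.sum_le_sum fun i hi => ?_
    have h3 := h2 i hi
    have h4 := hg _ (hc i hi)
    have h5 := hc i hi
    have hh : (1 - c i * p.eval (c i)) = g.eval (c i) * s.eval (c i) := by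
      rw [← hqe, hgs, eval_mul]
    rcases mul_eq_zero.1 h3 with h3 | h3
    · rcases mul_eq_zero.1 h3 with h3 | h3
      · rw [show c i * p.eval (c i) = 1 by linarith]; simp
      · have : s.eval (c i) = 0 := by
          rcases mul_eq_zero.1 h3 with h | h
          · exact absurd h (by positivity)
          · exact h
        rw [this, mul_zero] at hh
        rw [show c i * p.eval (c i) = 1 by linarith]; simp
    · rw [h3]; simp

/-! ### Polynomials in a symmetric operator and Krylov spaces in an eigenbasis -/

section Spectral

variable {d : ℕ} {A : EuclideanSpace ℝ (Fin d) →L[ℝ] EuclideanSpace ℝ (Fin d)}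

theorem exists_orthonormalBasis_eigenvectors
    (hA : (A : EuclideanSpace ℝ (Fin d) →ₗ[ℝ] EuclideanSpace ℝ (Fin d)).IsSymmetric) :
    ∃ (v : OrthonormalBasis (Fin d) ℝ (EuclideanSpace ℝ (Fin d))) (a : Fin d → ℝ),
      ∀ i, A (v i) = a i • v i :=
  ⟨hA.eigenvectorBasis finrank_euclideanSpace_fin, hA.eigenvalues finrank_euclideanSpace_fin,
    fun i => hA.apply_eigenvectorBasis finrank_euclideanSpace_fin i⟩

variable {v : OrthonormalBasis (Fin d) ℝ (EuclideanSpace ℝ (Fin d))} {a : Fin d → ℝ}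

open Polynomial in
theorem aeval_apply_eigenvector (hv : ∀ i, A (v i) = a i • v i) (p : ℝ[X]) (i : Fin d) :
    aeval A p (v i) = p.eval (a i) • v i := by
  induction p using Polynomial.induction_on' with
  | add p q hp hq => simp [hp, hq, add_smul]
  | monomial n c =>
    have : ∀ n : ℕ, (A ^ n) (v i) = a i ^ n • v i := by
      intro n
      induction n with
      | zero => simp
      | succ n ih => rw [pow_succ', mul_apply_eq_comp, ih, map_smul, hv, smul_smul,
          pow_succ]
    simp [aeval_monomial, this, ContinuousLinearMap.algebraMap_apply, smul_smul, mul_comm]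

open Polynomial in
theorem inner_aeval (hv : ∀ i, A (v i) = a i • v i) (p : ℝ[X]) (i : Fin d)
    (x : EuclideanSpace ℝ (Fin d)) :
    inner ℝ (v i) (aeval A p x) = p.eval (a i) * inner ℝ (v i) x := by
  conv_lhs => rw [← v.sum_repr' x]
  rw [map_sum, inner_sum, Finset.sum_eq_single i]
  · rw [map_smul, aeval_apply_eigenvector hv, inner_smul_right, inner_smul_right,
      real_inner_self_eq_norm_sq, v.norm_eq_one]
    ring
  · intro j _ hj
    rw [map_smul, aeval_apply_eigenvector hv, inner_smul_right, inner_smul_right,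
      v.inner_eq_zero hj.symm]
    ring
  · simp

open Polynomial in
theorem inner_eigenvector_apply (hv : ∀ i, A (v i) = a i • v i) (i : Fin d)
    (x : EuclideanSpace ℝ (Fin d)) :
    inner ℝ (v i) (A x) = a i * inner ℝ (v i) x := by
  simpa using inner_aeval hv X i x

theorem inner_eq_sum (v : OrthonormalBasis (Fin d) ℝ (EuclideanSpace ℝ (Fin d)))
    (x y : EuclideanSpace ℝ (Fin d)) :
    inner ℝ x y = ∑ i, inner ℝ (v i) x * inner ℝ (v i) y := by
  rw [← v.sum_inner_mul_inner]
  simp_rw [real_inner_comm x]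

theorem norm_sq_eq_sum (v : OrthonormalBasis (Fin d) ℝ (EuclideanSpace ℝ (Fin d)))
    (x : EuclideanSpace ℝ (Fin d)) : ‖x‖ ^ 2 = ∑ i, inner ℝ (v i) x ^ 2 := by
  rw [← real_inner_self_eq_norm_sq, inner_eq_sum v]
  simp_rw [sq]

theorem abs_eigenvalue_le (hv : ∀ i, A (v i) = a i • v i) {β : ℝ} (hβ : ‖A‖ ≤ β) (i : Fin d) :
    |a i| ≤ β := by
  have := (A.le_opNorm (v i)).trans (mul_le_mul_of_nonneg_right hβ (norm_nonneg _))
  rwa [hv, norm_smul, v.norm_eq_one, mul_one, mul_one, Real.norm_eq_abs] at this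

open Polynomial in
theorem aeval_mem_krylov {S : Set (EuclideanSpace ℝ (Fin d))} {x : EuclideanSpace ℝ (Fin d)}
    (hx : x ∈ S) {t : ℕ} {p : ℝ[X]} (hp : p.degree < t) : aeval A p x ∈ krylov t A S := by
  rw [aeval_eq_sum_range, sum_apply]
  refine Submodule.sum_mem _ fun j _ => ?_
  rw [smul_apply]
  by_cases hj : j < t
  · exact Submodule.smul_mem _ _ (Submodule.subset_span ⟨j, hj, x, hx, rfl⟩)
  · rw [coeff_eq_zero_of_degree_lt (hp.trans_le (by exact_mod_cast not_lt.1 hj)), zero_smul]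
    exact Submodule.zero_mem _

open Polynomial in
theorem exists_aeval_of_mem_krylov {b x : EuclideanSpace ℝ (Fin d)} {t : ℕ}
    (hx : x ∈ krylov t A {b}) : ∃ p : ℝ[X], p.degree < t ∧ x = aeval A p b := by
  induction hx using Submodule.span_induction with
  | mem x h =>
    obtain ⟨j, hj, w, rfl, rfl⟩ := h
    refine ⟨X ^ j, ?_, by simp⟩
    rw [degree_X_pow]; exact_mod_cast hj
  | zero => exact ⟨0, by simp, by simp⟩
  | add x y _ _ hx hy =>
    obtain ⟨p, hp, rfl⟩ := hx
    obtain ⟨q, hq, rfl⟩ := hy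
    exact ⟨p + q, (degree_add_le _ _).trans_lt (max_lt hp hq), by simp⟩
  | smul c x _ hx =>
    obtain ⟨p, hp, rfl⟩ := hx
    exact ⟨c • p, (degree_smul_le _ _).trans_lt hp, by simp⟩

theorem krylov_mono {S S' : Set (EuclideanSpace ℝ (Fin d))} (h : S ⊆ S') (t : ℕ) :
    krylov t A S ≤ krylov t A S' :=
  Submodule.span_mono fun _ ⟨j, hj, w, hw, e⟩ => ⟨j, hj, w, h hw, e⟩

end Spectral

/-! ### Negative curvature directions in a Krylov space -/

section NegativeCurvature

variable {d : ℕ} {A : EuclideanSpace ℝ (Fin d) →L[ℝ] EuclideanSpace ℝ (Fin d)}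
  {v : OrthonormalBasis (Fin d) ℝ (EuclideanSpace ℝ (Fin d))} {a : Fin d → ℝ}

open Polynomial in
/-- If the smallest eigenvalue lies well below `-c`, then a Krylov space of sufficiently large
order started from a unit vector contains a direction of curvature less than `-c`. -/
theorem exists_krylov_curvature_lt (hv : ∀ i, A (v i) = a i • v i) {β c φ : ℝ} (hβ : ‖A‖ ≤ β)
    (hc : 0 < c) (hβpos : 0 < β) (hφ : 0 ≤ φ) {u : EuclideanSpace ℝ (Fin d)} (hu : ‖u‖ = 1)
    {i₀ : Fin d} (hi₀ : a i₀ + c ≤ - (β + c) / 2 * (Real.cosh φ - 1)) (n : ℕ)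
    (hlarge : 2 < inner ℝ (v i₀) u ^ 2 * (Real.cosh ((2 * n + 1 : ℕ) * φ) - 1)) :
    ∃ z ∈ krylov (n + 1) A {u}, inner ℝ z (A z) < -c * ‖z‖ ^ 2 := by
  have hs : 0 < β + c := by linarith
  -- The quantity to control is `(x + c) p(x)²`. With a third-kind Chebyshev polynomial it is
  -- exactly an affine function of `T_{2n+1}`: bounded for `x ≥ -c` within the spectrum, and very
  -- negative at `a i₀` because `T_{2n+1}` is odd. The map `ℓ` sends `[-c, β]` to `[-1, 1]`.
  set w : ℝ[X] := Chebyshev.U ℝ n - Chebyshev.U ℝ ((n : ℤ) - 1) with hw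
  set ℓ : ℝ[X] := Polynomial.C (2 / (β + c)) * X + Polynomial.C (2 * c / (β + c) - 1) with hℓ
  have hℓe : ∀ x, ℓ.eval x = 2 * (x + c) / (β + c) - 1 := fun x => by simp [hℓ]; ring
  set p : ℝ[X] := w.comp ℓ with hp
  have hdeg : p.degree < (n + 1 : ℕ) := by
    refine degree_le_natDegree.trans_lt ?_
    have h1 : p.natDegree ≤ n * 1 := natDegree_comp_le.trans
      (Nat.mul_le_mul (degree_chebyshevU_sub_le n) natDegree_linear_le)
    exact_mod_cast (by omega : p.natDegree < n + 1)
  have hkey : ∀ x, (x + c) * p.eval x ^ 2 =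
      (β + c) / 2 * (1 + (Chebyshev.T ℝ (2 * n + 1 : ℕ)).eval (ℓ.eval x)) := fun x => by
    have := congrArg (eval (ℓ.eval x)) (one_add_X_mul_chebyshevU_sub_sq n)
    simp only [eval_mul, eval_add, eval_one, eval_X, eval_pow] at this
    push_cast
    rw [← this, hp, eval_comp, hw, hℓe]
    field_simp
    ring
  have hub : ∀ i, (a i + c) * p.eval (a i) ^ 2 ≤ β + c := fun i => by
    rcases le_or_gt (a i + c) 0 with h | h
    · exact (mul_nonpos_of_nonpos_of_nonneg h (sq_nonneg _)).trans hs.le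
    · rw [hkey]
      have hai := abs_le.1 (abs_eigenvalue_le hv hβ i)
      have : |ℓ.eval (a i)| ≤ 1 := by
        rw [hℓe, abs_le]
        constructor
        · have : 0 ≤ 2 * (a i + c) / (β + c) := by positivity
          linarith
        · have : 2 * (a i + c) / (β + c) ≤ 2 := by
            rw [div_le_iff₀ hs]; linarith [hai.2]
          linarith
      have := (abs_le.1 (Chebyshev.abs_eval_T_real_le_one (2 * n + 1 : ℕ) this)).2
      nlinarith
  have hi₀' : (a i₀ + c) * p.eval (a i₀) ^ 2 ≤
      (β + c) / 2 * (1 - Real.cosh ((2 * n + 1 : ℕ) * φ)) := by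
    rw [hkey]
    gcongr
    have h1 : Real.cosh φ ≤ -ℓ.eval (a i₀) := by
      rw [hℓe]
      have : 2 * (a i₀ + c) / (β + c) ≤ 1 - Real.cosh φ := by
        rw [div_le_iff₀ hs]; linarith
      linarith
    have h2 := cosh_mul_le_eval_chebyshevT (2 * n + 1) hφ h1
    rw [Chebyshev.T_eval_neg, Int.negOnePow_odd _ (by exact ⟨n, by push_cast; ring⟩)] at h2
    simp only [Units.val_neg, Units.val_one, Int.cast_neg, Int.cast_one] at h2
    linarith
  refine ⟨aeval A p u, aeval_mem_krylov (Set.mem_singleton u) hdeg, ?_⟩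
  have hsum : inner ℝ (aeval A p u) (A (aeval A p u)) + c * ‖aeval A p u‖ ^ 2 =
      ∑ i, (a i + c) * p.eval (a i) ^ 2 * inner ℝ (v i) u ^ 2 := by
    rw [inner_eq_sum v, norm_sq_eq_sum v, Finset.mul_sum, ← Finset.sum_add_distrib]
    refine Finset.sum_congr rfl fun i _ => ?_
    rw [inner_eigenvector_apply hv, inner_aeval hv]
    ring
  -- Since `‖u‖ = 1`, the components other than `i₀` contribute at most `β + c` in total, while
  -- `hlarge` pushes the `i₀` component below `-(β + c)`.
  have hle : ∑ i, ((β + c) - (a i + c) * p.eval (a i) ^ 2) * inner ℝ (v i) u ^ 2 ≥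
      (β + c - (a i₀ + c) * p.eval (a i₀) ^ 2) * inner ℝ (v i₀) u ^ 2 :=
    Finset.single_le_sum (f := fun i => ((β + c) - (a i + c) * p.eval (a i) ^ 2) *
      inner ℝ (v i) u ^ 2)
      (fun i _ => mul_nonneg (by linarith [hub i]) (sq_nonneg _)) (Finset.mem_univ i₀)
  have hnorm := norm_sq_eq_sum v u
  rw [hu] at hnorm
  simp_rw [sub_mul] at hle
  rw [Finset.sum_sub_distrib, ← Finset.mul_sum, ← hnorm, ← hsum] at hle
  have h5 := mul_le_mul_of_nonneg_right hi₀' (sq_nonneg (inner ℝ (v i₀) u))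
  have h6 := sq_nonneg (inner ℝ (v i₀) u)
  have h7 : 0 ≤ (β + c) * inner ℝ (v i₀) u ^ 2 := mul_nonneg hs.le h6
  nlinarith [mul_pos hs (sub_pos.2 hlarge)]

/-- Moving along a direction of negative curvature decreases the cubic model. -/
theorem exists_smul_cubicModel_lt {b z : EuclideanSpace ℝ (Fin d)} {ρ c : ℝ} (hρ : 0 < ρ)
    (hc : 0 < c) (hz : inner ℝ z (A z) < -c * ‖z‖ ^ 2) :
    ∃ α : ℝ, cubicModel A b ρ (α • z) < -(c ^ 3 / (6 * ρ ^ 2)) := by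
  have hz0 : 0 < ‖z‖ := by
    rw [norm_pos_iff]; rintro rfl; simp at hz
  -- The length `c/ρ` minimizes `-c t²/2 + ρ t³/3`; the sign makes the linear term harmless.
  obtain ⟨α, hα, hαb⟩ : ∃ α : ℝ, |α| = c / (ρ * ‖z‖) ∧ α * inner ℝ b z ≤ 0 := by
    have : 0 < c / (ρ * ‖z‖) := by positivity
    rcases le_total (inner ℝ b z) 0 with h | h
    · exact ⟨_, abs_of_pos this, mul_nonpos_of_nonneg_of_nonpos this.le h⟩
    · exact ⟨-(c / (ρ * ‖z‖)), by rw [abs_neg, abs_of_pos this], by nlinarith⟩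
  refine ⟨α, ?_⟩
  have h1 : cubicModel A b ρ (α • z) =
      1 / 2 * |α| ^ 2 * inner ℝ z (A z) + α * inner ℝ b z + ρ / 3 * (|α| * ‖z‖) ^ 3 := by
    simp only [cubicModel, quadModel, map_smul, inner_smul_left, inner_smul_right, norm_smul,
      Real.norm_eq_abs, sq_abs]
    simp only [conj_trivial]
    ring
  rw [h1, hα]
  have h2 : c / (ρ * ‖z‖) * ‖z‖ = c / ρ := by field_simp
  have h3 : 1 / 2 * (c / (ρ * ‖z‖)) ^ 2 * inner ℝ z (A z) < -(c ^ 3 / (2 * ρ ^ 2)) := by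
    calc _ < 1 / 2 * (c / (ρ * ‖z‖)) ^ 2 * (-c * ‖z‖ ^ 2) := by gcongr
      _ = _ := by field_simp
  rw [h2]
  have h4 : ρ / 3 * (c / ρ) ^ 3 = c ^ 3 / (3 * ρ ^ 2) := by field_simp
  rw [h4]
  have h5 : c ^ 3 / (6 * ρ ^ 2) = c ^ 3 / (2 * ρ ^ 2) - c ^ 3 / (3 * ρ ^ 2) := by field_simp; ring
  linarith

end NegativeCurvature

/-! ### Shifted linear systems: low cubic values and conjugate gradient bounds -/

section Regularized

variable {d : ℕ} {A : EuclideanSpace ℝ (Fin d) →L[ℝ] EuclideanSpace ℝ (Fin d)}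
  {v : OrthonormalBasis (Fin d) ℝ (EuclideanSpace ℝ (Fin d))} {a : Fin d → ℝ}

open Polynomial in
theorem degree_comp_X_add_C_lt {p : ℝ[X]} {t : ℕ} (hp : p.degree < t) (c : ℝ) :
    (p.comp (X + C c)).degree < t := by
  rcases eq_or_ne p 0 with rfl | h0
  · simp
  · refine degree_le_natDegree.trans_lt ?_
    rw [natDegree_comp, natDegree_X_add_C, mul_one, ← degree_eq_natDegree h0]
    exact hp

open Polynomial in
/-- Spectral coordinates of a shifted polynomial in `A` applied to `b`. -/
theorem inner_aeval_comp (hv : ∀ i, A (v i) = a i • v i) (p : ℝ[X]) (c : ℝ) (i : Fin d)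
    (x : EuclideanSpace ℝ (Fin d)) :
    inner ℝ (v i) (aeval A (p.comp (X + C c)) x) = p.eval (a i + c) * inner ℝ (v i) x := by
  rw [inner_aeval hv]; simp

theorem quadModel_add_eq_sum (hv : ∀ i, A (v i) = a i • v i) (c : ℝ)
    (b x : EuclideanSpace ℝ (Fin d)) :
    quadModel A b x + c * ‖x‖ ^ 2 =
      ∑ i, (1 / 2 * (a i + 2 * c) * inner ℝ (v i) x ^ 2 + inner ℝ (v i) b * inner ℝ (v i) x) := by
  rw [quadModel, inner_eq_sum v, inner_eq_sum v b, norm_sq_eq_sum v, Finset.mul_sum,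
    Finset.mul_sum, ← Finset.sum_add_distrib, ← Finset.sum_add_distrib]
  refine Finset.sum_congr rfl fun i _ => ?_
  rw [inner_eigenvector_apply hv]
  ring

open Polynomial in
/-- If the solution of `(A + ρr) s = -b` has norm larger than `r`, then Krylov spaces of `b`
contain points of low value of the cubic model. -/
theorem exists_krylov_cubicModel_lt (hv : ∀ i, A (v i) = a i • v i) {ρ r μ L : ℝ} (hρ : 0 < ρ)
    (hr : 0 < r) (hμ : 0 < μ) (hL : μ < L) (ha : ∀ i, a i + ρ * r ∈ Set.Icc μ L)
    {b s : EuclideanSpace ℝ (Fin d)}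
    (hs : ∀ i, (a i + ρ * r) * inner ℝ (v i) s = -inner ℝ (v i) b) (hsr : r < ‖s‖) {t : ℕ}
    (ht : 3 ≤ Real.cosh (t * (2 * Real.sqrt (μ / L)))) :
    ∃ x ∈ krylov t A {b}, cubicModel A b ρ x < -(1 / 12 * ρ * r ^ 3) := by
  obtain ⟨p, hp, hpa⟩ := exists_approx_inv hμ hL t
  set y : EuclideanSpace ℝ (Fin d) := -aeval A (p.comp (X + C (ρ * r))) b with hy
  have hyK : y ∈ krylov t A {b} :=
    Submodule.neg_mem _ (aeval_mem_krylov (Set.mem_singleton b) (degree_comp_X_add_C_lt hp _))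
  have hyi : ∀ i, inner ℝ (v i) s - inner ℝ (v i) y =
      (1 - (a i + ρ * r) * p.eval (a i + ρ * r)) * inner ℝ (v i) s := fun i => by
    rw [hy, inner_neg_right, inner_aeval_comp hv]
    linear_combination p.eval (a i + ρ * r) * hs i
  -- The relative error of at most `1/3` holds in every eigencoordinate, not only in norm. This
  -- gives the energy inequality `hby` termwise.
  have hei : ∀ i, (inner ℝ (v i) s - inner ℝ (v i) y) ^ 2 ≤ 1 / 9 * inner ℝ (v i) s ^ 2 := by
    intro i
    rw [hyi, mul_pow]
    gcongr
    have h1 := (hpa _ (ha i)).trans (one_div_le_one_div_of_le (by norm_num) ht)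
    have := sq_le_sq' (abs_le.1 h1).1 (abs_le.1 h1).2
    linarith
  have hnorm : ‖s - y‖ ≤ 1 / 3 * ‖s‖ := by
    apply le_of_sq_le_sq _ (by positivity)
    rw [mul_pow, norm_sq_eq_sum v, norm_sq_eq_sum v s, Finset.mul_sum]
    refine Finset.sum_le_sum fun i _ => ?_
    rw [inner_sub_right]
    linarith [hei i]
  have hm : 0 < ‖s‖ := hr.trans hsr
  -- Scaling by `θ < 1` brings the length into `[2r/3, 4r/3]`. Also `θ² Y ≤ θ Y`, so the `A + ρr`
  -- energy is absorbed by the linear term.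
  set θ := r / ‖s‖ with hθ
  have hθ0 : 0 < θ := by positivity
  have hθ1 : θ < 1 := by rw [hθ, div_lt_one hm]; exact hsr
  have hθm : θ * ‖s‖ = r := by rw [hθ]; field_simp
  refine ⟨θ • y, Submodule.smul_mem _ _ hyK, ?_⟩
  set Y := ∑ i, (a i + ρ * r) * inner ℝ (v i) y ^ 2 with hY
  have hY0 : 0 ≤ Y := Finset.sum_nonneg fun i _ =>
    mul_nonneg (hμ.le.trans (ha i).1) (sq_nonneg _)
  have hAy : inner ℝ y (A y) = Y - ρ * r * ‖y‖ ^ 2 := by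
    rw [inner_eq_sum v, norm_sq_eq_sum v, hY, Finset.mul_sum, ← Finset.sum_sub_distrib]
    refine Finset.sum_congr rfl fun i _ => ?_
    rw [inner_eigenvector_apply hv]
    ring
  have hby : Y ≤ -2 * inner ℝ b y := by
    rw [inner_eq_sum v, hY, Finset.mul_sum]
    refine Finset.sum_le_sum fun i _ => ?_
    have h1 := hei i
    have h2 := hs i
    have h3 : 0 ≤ a i + ρ * r := hμ.le.trans (ha i).1
    have h4 : inner ℝ (v i) y ^ 2 ≤ 2 * inner ℝ (v i) s * inner ℝ (v i) y := by
      nlinarith [sq_nonneg (inner ℝ (v i) s)]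
    have h5 := mul_le_mul_of_nonneg_left h4 h3
    have h6 : (inner ℝ (v i) b : ℝ) = -((a i + ρ * r) * inner ℝ (v i) s) := by linarith
    rw [h6]
    linarith
  have hval : cubicModel A b ρ (θ • y) =
      1 / 2 * θ ^ 2 * inner ℝ y (A y) + θ * inner ℝ b y + ρ / 3 * (θ * ‖y‖) ^ 3 := by
    simp only [cubicModel, quadModel, map_smul, inner_smul_left, inner_smul_right, norm_smul,
      Real.norm_eq_abs, abs_of_pos hθ0]
    simp only [conj_trivial]
    ring
  have hlow : 2 / 3 * r ≤ θ * ‖y‖ := by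
    have h1 : ‖s‖ - ‖y‖ ≤ ‖s - y‖ := norm_sub_norm_le _ _
    calc 2 / 3 * r = θ * (2 / 3 * ‖s‖) := by rw [← hθm]; ring
      _ ≤ _ := by gcongr; linarith
  have hup : θ * ‖y‖ ≤ 4 / 3 * r := by
    have h1 : ‖y‖ - ‖s‖ ≤ ‖s - y‖ := by rw [norm_sub_rev]; exact norm_sub_norm_le _ _
    calc θ * ‖y‖ ≤ θ * (4 / 3 * ‖s‖) := by gcongr; linarith
      _ = _ := by rw [← hθm]; ring
  have h1 : cubicModel A b ρ (θ • y) ≤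
      -(1 / 2 * ρ * r * (θ * ‖y‖) ^ 2) + ρ / 3 * (θ * ‖y‖) ^ 3 := by
    rw [hval, hAy]
    have h3 : θ * inner ℝ b y ≤ -(1 / 2 * θ * Y) := by nlinarith
    have h4 : θ ^ 2 * Y ≤ θ * Y := by
      apply mul_le_mul_of_nonneg_right _ hY0; nlinarith
    nlinarith
  refine h1.trans_lt ?_
  -- At length `(1 + h)r` the bound equals `ρr³ (-1/6 + h²/2 + h³/3)`, without a first-order term in
  -- `h`; `|h| ≤ 1/3` keeps it below `-ρr³/12`.
  obtain ⟨h, hh⟩ : ∃ h, θ * ‖y‖ = (1 + h) * r := ⟨θ * ‖y‖ / r - 1, by field_simp; ring⟩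
  rw [hh] at hlow hup ⊢
  have hl : -(1 / 3) ≤ h := by nlinarith
  have hu : h ≤ 1 / 3 := by nlinarith
  have h5 : h ^ 2 ≤ 1 / 9 := by nlinarith
  have h6 : h ^ 2 / 2 + h ^ 3 / 3 - 1 / 6 < -(1 / 12) := by
    nlinarith [mul_le_mul_of_nonneg_left hu (sq_nonneg h)]
  have h7 := mul_lt_mul_of_pos_left h6 (show 0 < ρ * r ^ 3 by positivity)
  linarith

theorem exists_mem_argminOn (hv : ∀ i, A (v i) = a i • v i) {R : ℝ} (hR : 0 < R)
    (ha : ∀ i, R ≤ a i + 2 * R) (b : EuclideanSpace ℝ (Fin d))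
    (K : Submodule ℝ (EuclideanSpace ℝ (Fin d))) :
    (argminOn (fun x => quadModel A b x + R * ‖x‖ ^ 2) K).Nonempty := by
  have hcont : Continuous fun x => quadModel A b x + R * ‖x‖ ^ 2 := by
    unfold quadModel; fun_prop
  -- Outside this ball `½R‖z‖²` dominates `‖b‖‖z‖`, so the objective exceeds its value 0 at the
  -- origin.
  have hcomp : IsCompact ((K : Set (EuclideanSpace ℝ (Fin d))) ∩
      Metric.closedBall 0 (2 * ‖b‖ / R)) :=
    (isCompact_closedBall _ _).inter_left K.closed_of_finiteDimensional
  obtain ⟨x, ⟨hxK, -⟩, hx⟩ := hcomp.exists_isMinOn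
    ⟨0, K.zero_mem, Metric.mem_closedBall_self (by positivity)⟩ hcont.continuousOn
  refine ⟨x, hxK, fun z hz => ?_⟩
  by_cases hzb : ‖z‖ ≤ 2 * ‖b‖ / R
  · exact hx ⟨hz, by simpa using hzb⟩
  · push Not at hzb
    have h0 : quadModel A b x + R * ‖x‖ ^ 2 ≤ 0 := by
      have := hx (show (0 : EuclideanSpace ℝ (Fin d)) ∈ _ from
        ⟨K.zero_mem, Metric.mem_closedBall_self (by positivity)⟩)
      simpa [quadModel] using this
    refine h0.trans ?_
    have h1 : 1 / 2 * R * ‖z‖ ^ 2 + inner ℝ b z ≤ quadModel A b z + R * ‖z‖ ^ 2 := by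
      rw [quadModel_add_eq_sum hv, inner_eq_sum v, norm_sq_eq_sum v, Finset.mul_sum,
        ← Finset.sum_add_distrib]
      refine Finset.sum_le_sum fun i _ => ?_
      have := mul_le_mul_of_nonneg_right (ha i) (sq_nonneg (inner ℝ (v i) z))
      linarith
    have h2 := (abs_le.1 (abs_real_inner_le_norm b z)).1
    rw [div_lt_iff₀ hR] at hzb
    nlinarith [norm_nonneg z, norm_nonneg b]

theorem eq_zero_of_forall_quadratic_nonneg {G H : ℝ} (hH : 0 ≤ H)
    (h : ∀ τ : ℝ, 0 ≤ τ * G + τ ^ 2 * H) : G = 0 := by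
  have h1 := h (-G / (H + 1))
  have h2 : -G / (H + 1) * G + (-G / (H + 1)) ^ 2 * H = -(G ^ 2 / (H + 1) ^ 2) := by
    field_simp; ring
  rw [h2] at h1
  have h3 : G ^ 2 / (H + 1) ^ 2 ≤ 0 := by linarith
  have h4 : 0 < (H + 1) ^ 2 := by positivity
  rw [div_le_iff₀ h4, zero_mul] at h3
  exact pow_eq_zero_iff (two_ne_zero) |>.1 (le_antisymm h3 (sq_nonneg _))

open Polynomial in
/-- The minimizer of the regularized model over a Krylov space: norm and residual. -/
theorem argminOn_krylov_bounds (hv : ∀ i, A (v i) = a i • v i) {R L r : ℝ} (hR : 0 < R)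
    (hL : R < L) (ha : ∀ i, a i + 2 * R ∈ Set.Icc R L) {b s : EuclideanSpace ℝ (Fin d)}
    (hs : ∀ i, (a i + R) * inner ℝ (v i) s = -inner ℝ (v i) b) (hsr : ‖s‖ ≤ r) {t : ℕ}
    {x : EuclideanSpace ℝ (Fin d)}
    (hx : x ∈ argminOn (fun x => quadModel A b x + R * ‖x‖ ^ 2) (krylov t A {b})) :
    ‖x‖ ≤ r ∧ ‖A x + (2 * R) • x + b‖ ≤ L * r / Real.cosh (t * (2 * Real.sqrt (R / L))) := by
  obtain ⟨hxK, hmin⟩ := hx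
  have hc : ∀ i, 0 < a i + 2 * R := fun i => hR.trans_le (ha i).1
  obtain ⟨y, hy⟩ : ∃ y : Fin d → ℝ, ∀ i, (a i + 2 * R) * y i = -inner ℝ (v i) b :=
    ⟨fun i => -inner ℝ (v i) b / (a i + 2 * R), fun i => by
      rw [mul_div_cancel₀ _ (hc i).ne']⟩
  -- Here `y` holds the eigencoordinates of the exact solution of `(A + 2R) y = -b`. Enlarging the
  -- shift from `R` to `2R` only shortens the solution, hence `|y i| ≤ |⟨v i, s⟩|`.
  have hb : ∀ i, (inner ℝ (v i) b : ℝ) = -((a i + 2 * R) * y i) := fun i => by rw [hy]; ring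
  have hr0 : 0 ≤ r := (norm_nonneg _).trans hsr
  have hysq : ∀ i, y i ^ 2 ≤ inner ℝ (v i) s ^ 2 := fun i => by
    have h1 : (a i + 2 * R) * y i = (a i + R) * inner ℝ (v i) s := by rw [hy, hs]
    have h2 : ((a i + 2 * R) * y i) ^ 2 ≤ ((a i + 2 * R) * inner ℝ (v i) s) ^ 2 := by
      rw [h1, mul_pow, mul_pow]
      have : (a i + R) ^ 2 ≤ (a i + 2 * R) ^ 2 := by nlinarith [(ha i).1]
      gcongr
    rw [mul_pow, mul_pow] at h2
    exact le_of_mul_le_mul_left h2 (pow_pos (hc i) 2)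
  have hysum : ∑ i, y i ^ 2 ≤ r ^ 2 := by
    calc ∑ i, y i ^ 2 ≤ ∑ i, inner ℝ (v i) s ^ 2 := Finset.sum_le_sum fun i _ => hysq i
      _ = ‖s‖ ^ 2 := (norm_sq_eq_sum v s).symm
      _ ≤ r ^ 2 := by gcongr
  have horth : ∀ h ∈ krylov t A {b},
      ∑ i, ((a i + 2 * R) * inner ℝ (v i) x + inner ℝ (v i) b) * inner ℝ (v i) h = 0 := by
    intro h hh
    refine eq_zero_of_forall_quadratic_nonneg
      (H := ∑ i, 1 / 2 * (a i + 2 * R) * inner ℝ (v i) h ^ 2) (Finset.sum_nonneg fun i _ =>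
        mul_nonneg (by linarith [hc i]) (sq_nonneg _)) fun τ => ?_
    have h1 := hmin (x + τ • h) (Submodule.add_mem _ hxK (Submodule.smul_mem _ _ hh))
    simp only [quadModel_add_eq_sum hv] at h1
    rw [← sub_nonneg, ← Finset.sum_sub_distrib] at h1
    refine h1.trans_eq ?_
    rw [Finset.mul_sum, Finset.mul_sum, ← Finset.sum_add_distrib]
    refine Finset.sum_congr rfl fun i _ => ?_
    rw [inner_add_right, inner_smul_right]
    ring
  constructor
  · obtain ⟨p, hp, hxp⟩ := exists_aeval_of_mem_krylov hxK
    set q : ℝ[X] := -(p.comp (X + C (-(2 * R)))) with hq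
    have hqd : q.degree < t := by rw [hq, degree_neg]; exact degree_comp_X_add_C_lt hp _
    have hxi : ∀ i, inner ℝ (v i) x = (a i + 2 * R) * q.eval (a i + 2 * R) * y i := fun i => by
      rw [hxp, inner_aeval hv, hb, hq]
      simp only [eval_neg, eval_comp, eval_add, eval_X, eval_C]
      rw [add_neg_cancel_right]
      ring
    have := sum_sq_le_of_orthogonal Finset.univ (fun i _ => hc i)
      (w := fun i => y i ^ 2) (fun i _ => sq_nonneg _) hqd (fun s hs => by
        have h1 := horth _ (aeval_mem_krylov (Set.mem_singleton b)
          (degree_comp_X_add_C_lt hs (2 * R)))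
        rw [← h1]
        refine Finset.sum_congr rfl fun i _ => ?_
        rw [inner_aeval_comp hv, hxi, hb]
        ring)
    apply le_of_sq_le_sq _ hr0
    rw [norm_sq_eq_sum v]
    refine le_trans (le_of_eq (Finset.sum_congr rfl fun i _ => ?_)) (this.trans hysum)
    rw [hxi]; ring
  · obtain ⟨p, hp, hpa⟩ := exists_approx_inv hR hL t
    have hL0 : 0 < L := hR.trans hL
    set η := 1 / Real.cosh (t * (2 * Real.sqrt (R / L))) with hη
    have hη0 : 0 < η := by have := Real.cosh_pos (t * (2 * Real.sqrt (R / L))); positivity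
    set z : EuclideanSpace ℝ (Fin d) := -aeval A (p.comp (X + C (2 * R))) b with hz
    have hzK : z ∈ krylov t A {b} :=
      Submodule.neg_mem _ (aeval_mem_krylov (Set.mem_singleton b) (degree_comp_X_add_C_lt hp _))
    have hzi : ∀ i, y i - inner ℝ (v i) z =
        (1 - (a i + 2 * R) * p.eval (a i + 2 * R)) * y i := fun i => by
      rw [hz, inner_neg_right, inner_aeval_comp hv, hb]
      ring
    have h1 := hmin z hzK
    simp only [quadModel_add_eq_sum hv] at h1
    -- Up to a factor and a constant, the objective is the squared energy distance to `y`, so `x` is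
    -- at least as close as the Chebyshev competitor `z`. One more factor `L` passes from energy to
    -- residual.
    have h2 : ∑ i, (a i + 2 * R) * (y i - inner ℝ (v i) x) ^ 2 ≤
        ∑ i, (a i + 2 * R) * (y i - inner ℝ (v i) z) ^ 2 := by
      have key : ∀ w : EuclideanSpace ℝ (Fin d),
          ∑ i, (a i + 2 * R) * (y i - inner ℝ (v i) w) ^ 2 =
          2 * ∑ i, (1 / 2 * (a i + 2 * R) * inner ℝ (v i) w ^ 2 +
            inner ℝ (v i) b * inner ℝ (v i) w) + ∑ i, (a i + 2 * R) * y i ^ 2 := fun w => by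
        rw [Finset.mul_sum, ← Finset.sum_add_distrib]
        refine Finset.sum_congr rfl fun i _ => ?_
        rw [hb]; ring
      rw [key, key]
      linarith
    have h3 : ∑ i, (a i + 2 * R) * (y i - inner ℝ (v i) z) ^ 2 ≤ L * η ^ 2 * r ^ 2 := by
      calc _ ≤ ∑ i, L * η ^ 2 * y i ^ 2 := by
            refine Finset.sum_le_sum fun i _ => ?_
            rw [hzi, mul_pow, ← mul_assoc]
            have h4 := hpa _ (ha i)
            have h5 := sq_le_sq' (abs_le.1 h4).1 (abs_le.1 h4).2
            have h6 := (ha i).2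
            have h7 := hc i
            gcongr
        _ = L * η ^ 2 * ∑ i, y i ^ 2 := by rw [Finset.mul_sum]
        _ ≤ _ := by gcongr
    rw [mul_div_assoc, div_eq_mul_one_div r, ← hη]
    apply le_of_sq_le_sq _ (by positivity)
    rw [norm_sq_eq_sum v]
    calc ∑ i, inner ℝ (v i) (A x + (2 * R) • x + b) ^ 2
        = ∑ i, (a i + 2 * R) * ((a i + 2 * R) * (y i - inner ℝ (v i) x) ^ 2) := by
          refine Finset.sum_congr rfl fun i _ => ?_
          rw [inner_add_right, inner_add_right, inner_smul_right, inner_eigenvector_apply hv, hb]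
          ring
      _ ≤ ∑ i, L * ((a i + 2 * R) * (y i - inner ℝ (v i) x) ^ 2) := by
          refine Finset.sum_le_sum fun i _ => ?_
          exact mul_le_mul_of_nonneg_right (ha i).2 (mul_nonneg (hc i).le (sq_nonneg _))
      _ = L * ∑ i, (a i + 2 * R) * (y i - inner ℝ (v i) x) ^ 2 := by rw [Finset.mul_sum]
      _ ≤ L * (L * η ^ 2 * r ^ 2) := by gcongr; exact h2.trans h3
      _ = _ := by ring

end Regularized

/-! ### The prescribed Krylov orders suffice -/

section StepCounts

theorem le_innerSteps_sq (d : ℕ) {ρ β r δ : ℝ} (hρ : 0 < ρ) (hβ : 0 < β) (hr : 0 < r) :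
    24 * (4 + 1 / 2 * Real.log (4 * d / δ ^ 2) ^ 2) ≤
      (innerSteps d ρ β r δ : ℝ) ^ 2 * (ρ * r / β) := by
  have h1 : Real.sqrt (24 * β / (ρ * r) * (4 + 1 / 2 * Real.log (4 * d / δ ^ 2) ^ 2)) ≤
      innerSteps d ρ β r δ := Nat.le_ceil _
  have h2 := (Real.sqrt_le_left (Nat.cast_nonneg _)).1 h1
  calc 24 * (4 + 1 / 2 * Real.log (4 * d / δ ^ 2) ^ 2)
      = 24 * β / (ρ * r) * (4 + 1 / 2 * Real.log (4 * d / δ ^ 2) ^ 2) * (ρ * r / β) := by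
        field_simp
    _ ≤ _ := by gcongr

theorem exp_le_two_mul_cosh (x : ℝ) : Real.exp x ≤ 2 * Real.cosh x := by
  rw [Real.cosh_eq]; linarith [Real.exp_pos (-x)]

theorem cosh_le_one_add_sq {φ : ℝ} (h : φ ^ 2 ≤ 1) : Real.cosh φ ≤ 1 + φ ^ 2 := by
  have h1 := Real.cosh_le_exp_half_sq φ
  have h2 := Real.abs_exp_sub_one_sub_id_le (x := φ ^ 2 / 2)
    (by rw [abs_of_nonneg (by positivity)]; linarith)
  have h3 := (abs_le.1 h2).2
  nlinarith [sq_nonneg φ]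

/-- The spectral interval is `[ρr/10, β + ρr]`. With `β ≥ 3ρr`, the squared argument of `cosh` is at
least `(3/10)·24·4 > 25`, and `cosh 5 ≥ e⁵/2 ≥ 3`. -/
theorem three_le_cosh_innerSteps (d : ℕ) {ρ β r δ : ℝ} (hρ : 0 < ρ) (hβ : 0 < β) (hr : 0 < r)
    (hrβ : 3 * (ρ * r) ≤ β) :
    3 ≤ Real.cosh (innerSteps d ρ β r δ * (2 * Real.sqrt (ρ * r / 10 / (β + ρ * r)))) := by
  have h1 := le_innerSteps_sq d (δ := δ) hρ hβ hr
  set t : ℝ := ((innerSteps d ρ β r δ : ℕ) : ℝ) with ht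
  have ht0 : 0 ≤ t := Nat.cast_nonneg _
  have hR : 0 < ρ * r := by positivity
  set x := t * (2 * Real.sqrt (ρ * r / 10 / (β + ρ * r))) with hx
  have hx0 : 0 ≤ x := by positivity
  have hxsq : 5 ^ 2 ≤ x ^ 2 := by
    rw [hx, mul_pow, mul_pow, Real.sq_sqrt (by positivity)]
    have h2 : 3 / 10 * (ρ * r / β) ≤ 2 ^ 2 * (ρ * r / 10 / (β + ρ * r)) := by
      rw [← sub_nonneg]
      have : 2 ^ 2 * (ρ * r / 10 / (β + ρ * r)) - 3 / 10 * (ρ * r / β) =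
        (ρ * r) * (β - 3 * (ρ * r)) / (10 * β * (β + ρ * r)) := by field_simp; ring
      rw [this]
      have : 0 ≤ β - 3 * (ρ * r) := by linarith
      positivity
    have h3 := mul_le_mul_of_nonneg_left h2 (sq_nonneg t)
    nlinarith [sq_nonneg (Real.log (4 * d / δ ^ 2))]
  have hx5 : 5 ≤ x := le_of_sq_le_sq hxsq hx0
  have := exp_le_two_mul_cosh x
  have := Real.add_one_le_exp x
  linarith

/-- Order `T` allows polynomials of degree `T - 1`, hence the Chebyshev index `2(T - 1) + 1 ≥ T`.
The constants make the argument of `cosh` at least `2 + log (4d/δ²)`, so `cosh` outweighs the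
smallest admissible squared component `δ²/(4d)` by a factor `7/2`. -/
theorem two_lt_mul_cosh_innerSteps {d : ℕ} (hd : 0 < d) {ρ β r δ κ : ℝ} (hρ : 0 < ρ)
    (hβ : 0 < β) (hr : 0 < r) (hδ : 0 < δ) (hκ1 : κ ≤ 1)
    (hκ : δ ^ 2 / (4 * d) ≤ κ) :
    1 ≤ innerSteps d ρ β r δ ∧
    2 < κ * (Real.cosh ((2 * (innerSteps d ρ β r δ - 1) + 1 : ℕ) *
      Real.sqrt (3 / 20 * (ρ * r / β))) - 1) := by
  have h1 := le_innerSteps_sq d (δ := δ) hρ hβ hr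
  have hR : 0 < ρ * r := by positivity
  set ℓ := Real.log (4 * d / δ ^ 2) with hℓ
  have hT : 1 ≤ innerSteps d ρ β r δ := by
    by_contra h
    have h0 : innerSteps d ρ β r δ = 0 := by omega
    rw [h0] at h1
    norm_num at h1
    nlinarith [sq_nonneg ℓ]
  refine ⟨hT, ?_⟩
  set m := 2 * (innerSteps d ρ β r δ - 1) + 1 with hm
  have hmT : (innerSteps d ρ β r δ : ℝ) ≤ m := by exact_mod_cast (by omega)
  set E := (m : ℝ) * Real.sqrt (3 / 20 * (ρ * r / β)) with hE
  have hE0 : 0 ≤ E := by positivity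
  have hEsq : (2 + ℓ) ^ 2 ≤ E ^ 2 := by
    rw [hE, mul_pow, Real.sq_sqrt (by positivity)]
    have h2 : (innerSteps d ρ β r δ : ℝ) ^ 2 * (ρ * r / β) ≤ (m : ℝ) ^ 2 * (ρ * r / β) := by
      gcongr
    nlinarith [sq_nonneg (ℓ - 5 / 2)]
  have hEℓ : 2 + ℓ ≤ E := le_of_sq_le_sq hEsq hE0
  have h3 := exp_le_two_mul_cosh E
  have h4 : Real.exp (2 + ℓ) ≤ Real.exp E := Real.exp_le_exp.2 hEℓ
  have hd' : (0 : ℝ) < d := by exact_mod_cast hd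
  rw [Real.exp_add, hℓ, Real.exp_log (by positivity)] at h4
  have h5 : (7 : ℝ) ≤ Real.exp 2 := by
    have := Real.exp_one_gt_d9
    rw [show (2 : ℝ) = 1 + 1 by norm_num, Real.exp_add]
    nlinarith
  have h6 : 7 / 2 * (4 * d / δ ^ 2) ≤ Real.cosh E := by
    have : 0 < 4 * d / δ ^ 2 := by positivity
    nlinarith
  have hκ0 : 0 < κ := lt_of_lt_of_le (by positivity) hκ
  have h7 : 7 / 2 ≤ κ * Real.cosh E := by
    calc 7 / 2 = δ ^ 2 / (4 * d) * (7 / 2 * (4 * d / δ ^ 2)) := by field_simp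
      _ ≤ _ := by gcongr
  linarith

/-- The logarithm in the order is twice `log (6Lr/ε_g)` with `L = β + 2ρr`; hence `cosh ≥ 3Lr/ε_g`,
with a factor 3 to spare. -/
theorem div_cosh_finalSteps_le {ρ β r εg : ℝ} (hρ : 0 < ρ) (hβ : 0 < β) (hr : 0 < r)
    (hε : 0 < εg) :
    (β + 2 * ρ * r) * r / Real.cosh (finalSteps ρ β r εg *
      (2 * Real.sqrt (ρ * r / (β + 2 * ρ * r)))) ≤ εg := by
  set L := β + 2 * ρ * r with hL
  have hL0 : 0 < L := by positivity
  have hR : 0 < ρ * r := by positivity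
  set t : ℝ := ((finalSteps ρ β r εg : ℕ) : ℝ) with ht
  have h1 : 1 / 4 * Real.sqrt (L / (ρ * r)) * Real.log (36 * L ^ 2 * r ^ 2 / εg ^ 2) ≤ t :=
    Nat.le_ceil _
  set x := t * (2 * Real.sqrt (ρ * r / L)) with hx
  have hs : Real.sqrt (L / (ρ * r)) * Real.sqrt (ρ * r / L) = 1 := by
    rw [← Real.sqrt_mul (by positivity)]
    rw [show L / (ρ * r) * (ρ * r / L) = 1 by field_simp, Real.sqrt_one]
  have h2 : Real.log (6 * L * r / εg) ≤ x := by
    have h3 : Real.log (36 * L ^ 2 * r ^ 2 / εg ^ 2) = 2 * Real.log (6 * L * r / εg) := by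
      rw [show 36 * L ^ 2 * r ^ 2 / εg ^ 2 = (6 * L * r / εg) ^ 2 by ring, Real.log_pow]
      norm_num
    rw [h3] at h1
    calc Real.log (6 * L * r / εg)
        = 1 / 4 * Real.sqrt (L / (ρ * r)) * (2 * Real.log (6 * L * r / εg)) *
            (2 * Real.sqrt (ρ * r / L)) := by
          linear_combination -Real.log (6 * L * r / εg) * hs
      _ ≤ _ := mul_le_mul_of_nonneg_right h1 (by positivity)
  have h4 := exp_le_two_mul_cosh x
  have h5 := Real.exp_le_exp.2 h2
  rw [Real.exp_log (by positivity)] at h5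
  rw [div_le_iff₀ (Real.cosh_pos x)]
  have h6 : 6 * L * r / εg * εg = 6 * L * r := by field_simp
  have h7 : 0 < L * r := by positivity
  nlinarith

end StepCounts

/-! ### Low model value or successful final step -/

section Dichotomy

variable {d : ℕ} {A : EuclideanSpace ℝ (Fin d) →L[ℝ] EuclideanSpace ℝ (Fin d)}

/-- Either most directions `u` yield a point of low value of the cubic model, or the final
quadratic step succeeds. -/
theorem low_cubicModel_or_solveQuadratic
    (hA : (A : EuclideanSpace ℝ (Fin d) →ₗ[ℝ] EuclideanSpace ℝ (Fin d)).IsSymmetric)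
    {β ρ r δ εg : ℝ} (hβ : ‖A‖ ≤ β) (hβ0 : 0 < β) (hρ : 0 < ρ) (hr : 0 < r) (hδ : 0 < δ)
    (hrβ : 3 * (ρ * r) ≤ β) (hε : 0 < εg) (b : EuclideanSpace ℝ (Fin d)) :
    (∃ (v : OrthonormalBasis (Fin d) ℝ (EuclideanSpace ℝ (Fin d))) (i : Fin d),
      ∀ u : EuclideanSpace ℝ (Fin d), ‖u‖ = 1 → δ ^ 2 / (4 * d) ≤ inner ℝ (v i) u ^ 2 →
      ∃ x ∈ krylov (innerSteps d ρ β r δ) A {b, u}, cubicModel A b ρ x < -(1 / 12 * ρ * r ^ 3)) ∨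
    (∀ u : EuclideanSpace ℝ (Fin d),
      ∃ x ∈ krylov (innerSteps d ρ β r δ) A {b, u}, cubicModel A b ρ x < -(1 / 12 * ρ * r ^ 3)) ∨
    ((solveQuadratic A b ρ β r εg).Nonempty ∧ (∀ h, -(ρ * r) * ‖h‖ ^ 2 ≤ inner ℝ h (A h)) ∧
      ∀ x ∈ solveQuadratic A b ρ β r εg, ‖x‖ ≤ r ∧ ‖A x + (2 * (ρ * r)) • x + b‖ ≤ εg) := by
  obtain ⟨v, a, hv⟩ := exists_orthonormalBasis_eigenvectors hA
  have hR : 0 < ρ * r := by positivity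
  have hab := fun i => abs_le.1 (abs_eigenvalue_le hv hβ i)
  -- The gap between `9/10` and the curvature `4/5` found below pays for the finite Krylov order,
  -- while `(4/5)³/6 = 64/750` still exceeds `1/12`.
  by_cases hneg : ∃ i, a i ≤ -(9 / 10 * (ρ * r))
  · left
    obtain ⟨i, hi⟩ := hneg
    refine ⟨v, i, fun u hu hui => ?_⟩
    have hκ1 : inner ℝ (v i) u ^ 2 ≤ 1 := by
      have := abs_real_inner_le_norm (v i) u
      rw [hu, v.norm_eq_one, mul_one] at this
      exact (sq_le_one_iff_abs_le_one _).2 this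
    obtain ⟨hT, hlarge⟩ := two_lt_mul_cosh_innerSteps i.pos hρ hβ0 hr hδ hκ1 hui
    have hφ : Real.sqrt (3 / 20 * (ρ * r / β)) ^ 2 = 3 / 20 * (ρ * r / β) :=
      Real.sq_sqrt (by positivity)
    have hRβ : ρ * r / β ≤ 1 / 3 := by rw [div_le_iff₀ hβ0]; linarith
    have hcosh := cosh_le_one_add_sq (φ := Real.sqrt (3 / 20 * (ρ * r / β)))
      (by rw [hφ]; linarith)
    rw [hφ] at hcosh
    obtain ⟨z, hz, hzA⟩ := exists_krylov_curvature_lt hv hβ (c := 4 / 5 * (ρ * r)) (by positivity)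
      hβ0 (Real.sqrt_nonneg _) hu (i₀ := i) (by
        have h1 : (β + 4 / 5 * (ρ * r)) / 2 *
            (Real.cosh (Real.sqrt (3 / 20 * (ρ * r / β))) - 1) ≤
            (β + 4 / 5 * (ρ * r)) / 2 * (3 / 20 * (ρ * r / β)) := by
          gcongr; linarith
        have h2 : (β + 4 / 5 * (ρ * r)) / 2 * (3 / 20 * (ρ * r / β)) ≤ 1 / 10 * (ρ * r) := by
          have h3 : β * (ρ * r / β) = ρ * r := by field_simp
          nlinarith
        linarith) _ hlarge
    rw [Nat.sub_add_cancel hT] at hz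
    obtain ⟨α, hα⟩ := exists_smul_cubicModel_lt (b := b) hρ (by positivity) hzA
    refine ⟨α • z, Submodule.smul_mem _ _ (krylov_mono (by simp) _ hz), hα.trans ?_⟩
    have h1 : (4 / 5 * (ρ * r)) ^ 3 / (6 * ρ ^ 2) = 64 / 750 * (ρ * r ^ 3) := by field_simp; norm_num
    have h2 : 0 < ρ * r ^ 3 := by positivity
    rw [h1]; linarith
  · right
    push Not at hneg
    have hpos : ∀ i, 0 < a i + ρ * r := fun i => by linarith [hneg i]
    set s : EuclideanSpace ℝ (Fin d) := ∑ i, (-inner ℝ (v i) b / (a i + ρ * r)) • v i with hs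
    have hsi : ∀ i, (a i + ρ * r) * inner ℝ (v i) s = -inner ℝ (v i) b := fun i => by
      rw [hs, v.orthonormal.inner_right_fintype, mul_div_cancel₀ _ (hpos i).ne']
    rcases lt_or_ge r ‖s‖ with h | h
    · left
      intro u
      obtain ⟨x, hx, hxc⟩ := exists_krylov_cubicModel_lt hv hρ hr (μ := ρ * r / 10)
        (L := β + ρ * r) (by positivity) (by linarith)
        (fun i => ⟨by linarith [hneg i], by linarith [(hab i).2]⟩) hsi h
        (three_le_cosh_innerSteps d (δ := δ) hρ hβ0 hr hrβ)
      exact ⟨x, krylov_mono (by simp) _ hx, hxc⟩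
    · right
      have ha2 : ∀ i, a i + 2 * (ρ * r) ∈ Set.Icc (ρ * r) (β + 2 * ρ * r) := fun i =>
        ⟨by linarith [hpos i], by linarith [(hab i).2]⟩
      refine ⟨exists_mem_argminOn hv hR (fun i => (ha2 i).1) b _, fun h => ?_, fun x hx => ?_⟩
      · rw [inner_eq_sum v, norm_sq_eq_sum v, Finset.mul_sum]
        refine Finset.sum_le_sum fun i _ => ?_
        rw [inner_eigenvector_apply hv]
        nlinarith [mul_nonneg (hpos i).le (sq_nonneg (inner ℝ (v i) h))]
      · obtain ⟨h1, h2⟩ := argminOn_krylov_bounds hv hR (by linarith) ha2 hsi h hx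
        exact ⟨h1, h2.trans (div_cosh_finalSteps_le hρ hβ0 hr hε)⟩

end Dichotomy

/-! ### Taylor bounds and second-order stationarity -/

section Calculus

namespace SmoothObjective

variable {d : ℕ} {g : EuclideanSpace ℝ (Fin d) → ℝ} {β ρ : ℝ}

theorem hasFDerivAt_gradient (h : SmoothObjective g β ρ) (y : EuclideanSpace ℝ (Fin d)) :
    HasFDerivAt (∇ g) (hessian g y) y :=
  (h.differentiable_gradient y).hasFDerivAt

theorem norm_hessian_le (h : SmoothObjective g β ρ) (hβ : 0 ≤ β) (y : EuclideanSpace ℝ (Fin d)) :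
    ‖hessian g y‖ ≤ β := by
  have : LipschitzWith ⟨β, hβ⟩ (∇ g) :=
    LipschitzWith.of_dist_le_mul fun x y => by
      rw [dist_eq_norm, dist_eq_norm]; exact h.smooth x y
  exact norm_fderiv_le_of_lipschitz ℝ this

theorem continuous_hessian (h : SmoothObjective g β ρ) (hρ : 0 ≤ ρ) : Continuous (hessian g) := by
  have : LipschitzWith ⟨2 * ρ, by positivity⟩ (hessian g) :=
    LipschitzWith.of_dist_le_mul fun x y => by
      rw [dist_eq_norm, dist_eq_norm]; exact h.hessian_lipschitz x y
  exact this.continuous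

theorem isSymmetric_hessian (h : SmoothObjective g β ρ) (y : EuclideanSpace ℝ (Fin d)) :
    (hessian g y : EuclideanSpace ℝ (Fin d) →ₗ[ℝ] EuclideanSpace ℝ (Fin d)).IsSymmetric := by
  intro v w
  have h1 : ∀ x, HasFDerivAt g (InnerProductSpace.toDual ℝ _ (∇ g x)) x := fun x =>
    (h.differentiable x).hasGradientAt.hasFDerivAt
  have h2 : HasFDerivAt (fun x => InnerProductSpace.toDual ℝ (EuclideanSpace ℝ (Fin d)) (∇ g x))
      ((InnerProductSpace.toDual ℝ (EuclideanSpace ℝ (Fin d))).toContinuousLinearEquiv.toContinuousLinearMap.comp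
        (hessian g y)) y :=
    ((InnerProductSpace.toDual ℝ
      (EuclideanSpace ℝ (Fin d))).toContinuousLinearEquiv.toContinuousLinearMap.hasFDerivAt).comp y
      (h.hasFDerivAt_gradient y)
  have h3 := second_derivative_symmetric h1 h2 v w
  simp at h3
  rw [real_inner_comm]
  simpa [real_inner_comm] using h3

/-- Along the segment the derivative of the remainder is at most `2ρ t ‖x‖²`, which integrates to
`ρ‖x‖²`. -/
theorem norm_gradient_sub_le (h : SmoothObjective g β ρ)
    (y x : EuclideanSpace ℝ (Fin d)) :
    ‖∇ g (y + x) - ∇ g y - hessian g y x‖ ≤ ρ * ‖x‖ ^ 2 := by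
  have hline : ∀ t : ℝ, HasDerivAt (fun t : ℝ => y + t • x) x t := fun t => by
    simpa using ((hasDerivAt_id t).smul_const x).const_add y
  have hder : ∀ t : ℝ, HasDerivAt
      (fun t : ℝ => ∇ g (y + t • x) - ∇ g y - t • hessian g y x)
      (hessian g (y + t • x) x - hessian g y x) t := fun t => by
    have h1 := ((h.hasFDerivAt_gradient (y + t • x)).comp_hasDerivAt t (hline t)).sub_const (∇ g y)
    have h2 := (hasDerivAt_id t).smul_const (hessian g y x)
    exact (h1.sub h2).congr_deriv (by simp)
  have key := image_norm_le_of_norm_deriv_right_le_deriv_boundary (a := 0) (b := 1)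
    (f := fun t : ℝ => ∇ g (y + t • x) - ∇ g y - t • hessian g y x)
    (f' := fun t => hessian g (y + t • x) x - hessian g y x)
    (B := fun t => ρ * ‖x‖ ^ 2 * t ^ 2) (B' := fun t => ρ * ‖x‖ ^ 2 * (2 * t))
    (fun t _ => (hder t).continuousAt.continuousWithinAt)
    (fun t _ => (hder t).hasDerivWithinAt) (by simp)
    (fun t => by simpa using (hasDerivAt_pow 2 t).const_mul (ρ * ‖x‖ ^ 2))
    (fun t ht => by
      rw [← sub_apply]
      refine (ContinuousLinearMap.le_opNorm _ _).trans ?_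
      have h1 := h.hessian_lipschitz (y + t • x) y
      rw [add_sub_cancel_left, norm_smul, Real.norm_eq_abs, abs_of_nonneg ht.1] at h1
      calc _ ≤ 2 * ρ * (t * ‖x‖) * ‖x‖ := by gcongr
        _ = _ := by ring) (Set.right_mem_Icc.2 zero_le_one)
  simpa using key

/-- Integrating the gradient bound once more along the segment produces the coefficient `ρ/3`. -/
theorem le_add_cubicModel (h : SmoothObjective g β ρ) (y x : EuclideanSpace ℝ (Fin d)) :
    g (y + x) ≤ g y + cubicModel (hessian g y) (∇ g y) ρ x := by
  have hline : ∀ t : ℝ, HasDerivAt (fun t : ℝ => y + t • x) x t := fun t => by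
    simpa using ((hasDerivAt_id t).smul_const x).const_add y
  have hder : ∀ t : ℝ, HasDerivAt
      (fun t : ℝ => g (y + t • x))
      (inner ℝ (∇ g (y + t • x)) x) t := fun t => by
    have h1 := ((h.differentiable (y + t • x)).hasGradientAt.hasFDerivAt).comp_hasDerivAt t (hline t)
    exact h1.congr_deriv (by simp)
  have hB : ∀ t : ℝ, HasDerivAt
      (fun t : ℝ => g y + t * inner ℝ (∇ g y) x + t ^ 2 / 2 * inner ℝ x (hessian g y x)
        + ρ * ‖x‖ ^ 3 / 3 * t ^ 3)
      (inner ℝ (∇ g y) x + t * inner ℝ x (hessian g y x) + ρ * ‖x‖ ^ 3 * t ^ 2) t := fun t => by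
    have h1 := ((hasDerivAt_id t).mul_const (inner ℝ (∇ g y) x)).const_add (g y)
    have h2 := ((hasDerivAt_pow 2 t).div_const 2).mul_const (inner ℝ x (hessian g y x))
    have h3 := (hasDerivAt_pow 3 t).const_mul (ρ * ‖x‖ ^ 3 / 3)
    refine ((h1.add h2).add h3).congr_deriv ?_
    simp; ring
  have key := image_le_of_deriv_right_le_deriv_boundary (a := 0) (b := 1)
    (f := fun t : ℝ => g (y + t • x))
    (f' := fun t => inner ℝ (∇ g (y + t • x)) x)
    (B := fun t : ℝ => g y + t * inner ℝ (∇ g y) x + t ^ 2 / 2 * inner ℝ x (hessian g y x)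
        + ρ * ‖x‖ ^ 3 / 3 * t ^ 3)
    (B' := fun t => inner ℝ (∇ g y) x + t * inner ℝ x (hessian g y x) + ρ * ‖x‖ ^ 3 * t ^ 2)
    (fun t _ => (hder t).continuousAt.continuousWithinAt)
    (fun t _ => (hder t).hasDerivWithinAt) (by simp)
    (fun t _ => (hB t).continuousAt.continuousWithinAt)
    (fun t _ => (hB t).hasDerivWithinAt)
    (fun t ht => by
      have h1 := h.norm_gradient_sub_le y (t • x)
      have h2 := (real_inner_le_norm (∇ g (y + t • x) - ∇ g y - hessian g y (t • x)) x).trans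
        (mul_le_mul_of_nonneg_right h1 (norm_nonneg x))
      rw [inner_sub_left, inner_sub_left, map_smul, inner_smul_left, norm_smul, Real.norm_eq_abs,
        abs_of_nonneg ht.1, real_inner_comm x (hessian g y x)] at h2
      simp only [conj_trivial] at h2
      linarith) (Set.right_mem_Icc.2 zero_le_one)
  simp only [one_smul, one_mul, one_pow, mul_one] at key
  refine key.trans_eq ?_
  rw [cubicModel, quadModel]
  ring

/-- A short step with small residual from a point of almost nonnegative curvature leads to a
second-order stationary point. -/
theorem isSecondOrderStationary_add (h : SmoothObjective g β ρ) (hρ : 0 < ρ) {ε : ℝ} (hε : 0 < ε)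
    {y x : EuclideanSpace ℝ (Fin d)} (hx : ‖x‖ ≤ stepRadius ρ ε)
    (hres : ‖hessian g y x + (2 * (ρ * stepRadius ρ ε)) • x + ∇ g y‖ ≤ 2 * ε / 3)
    (hcurv : ∀ w, -(ρ * stepRadius ρ ε) * ‖w‖ ^ 2 ≤ inner ℝ w (hessian g y w)) :
    IsSecondOrderStationary g ρ ε (y + x) := by
  set r := stepRadius ρ ε with hr
  have hr0 : 0 ≤ r := Real.sqrt_nonneg _
  -- The budget: the gradient is at most `ρr² + 2ε/3 + 2ρr² = ε`, and the curvature drops from `-ρr`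
  -- by at most `2ρr` to `-3ρr = -√(ρε)`.
  have hrsq : ρ * r ^ 2 = ε / 9 := by
    rw [hr, stepRadius, Real.sq_sqrt (by positivity)]; field_simp
  have hsqrt : Real.sqrt (ρ * ε) = 3 * (ρ * r) := by
    rw [Real.sqrt_eq_iff_mul_self_eq (by positivity) (by positivity)]
    nlinarith
  constructor
  · have h1 := h.norm_gradient_sub_le y x
    have h2 : ∇ g (y + x) = (∇ g (y + x) - ∇ g y - hessian g y x) +
        (hessian g y x + (2 * (ρ * r)) • x + ∇ g y) - (2 * (ρ * r)) • x := by abel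
    have h3 : ‖(2 * (ρ * r)) • x‖ ≤ 2 * (ρ * r) * r := by
      rw [norm_smul, Real.norm_eq_abs, abs_of_nonneg (by positivity)]; gcongr
    have h4 : ρ * ‖x‖ ^ 2 ≤ ρ * r ^ 2 := by gcongr
    rw [h2]
    refine (norm_sub_le _ _).trans ((add_le_add_left (norm_add_le _ _) _).trans ?_)
    nlinarith
  · rw [ContinuousLinearMap.le_def]
    refine (ContinuousLinearMap.isPositive_iff _).2 ⟨?_, fun w => ?_⟩
    · intro u w
      have := h.isSymmetric_hessian (y + x) u w
      simp only [ContinuousLinearMap.coe_coe] at this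
      simp [inner_add_left, inner_add_right, this, inner_smul_left, inner_smul_right]
    · have h1 := hcurv w
      have h2 := h.hessian_lipschitz (y + x) y
      rw [add_sub_cancel_left] at h2
      have h3 : |inner ℝ w ((hessian g (y + x) - hessian g y) w)| ≤ 2 * (ρ * r) * ‖w‖ ^ 2 := by
        refine (abs_real_inner_le_norm _ _).trans ?_
        calc _ ≤ ‖w‖ * (2 * ρ * ‖x‖ * ‖w‖) := by
              gcongr
              exact (ContinuousLinearMap.le_opNorm _ _).trans (by gcongr)
          _ ≤ ‖w‖ * (2 * ρ * r * ‖w‖) := by gcongr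
          _ = _ := by ring
      have h4 := (abs_le.1 h3).1
      rw [sub_apply, inner_sub_right] at h4
      rw [sub_neg_eq_add, add_apply, inner_add_left, hsqrt]
      simp only [smul_apply, ContinuousLinearMap.id_apply, inner_smul_left, conj_trivial,
        real_inner_self_eq_norm_sq]
      rw [real_inner_comm]
      nlinarith

end SmoothObjective
end Calculus

/-! ### Anti-concentration on the sphere -/

section Sphere

/-- The square of the right side is `(1 + 1/n)⁻ⁿ ≥ 1/e > 1/4`. It bounds the determinant of the map
that stretches the slab. -/
theorem half_le_sqrt_pow (n : ℕ) : 1 / 2 ≤ Real.sqrt (1 - 1 / ((n : ℝ) + 1)) ^ n := by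
  rcases Nat.eq_zero_or_pos n with rfl | hn
  · norm_num
  have hn' : (0 : ℝ) < n := by exact_mod_cast hn
  apply le_of_sq_le_sq _ (by positivity)
  have h1 : (0 : ℝ) ≤ 1 - 1 / ((n : ℝ) + 1) := by
    rw [sub_nonneg, div_le_one (by positivity)]; linarith
  rw [← pow_mul, mul_comm, pow_mul, Real.sq_sqrt h1]
  have h2 : 1 - 1 / ((n : ℝ) + 1) = (1 + 1 / (n : ℝ))⁻¹ := by field_simp; ring
  have h3 : (1 + 1 / (n : ℝ)) ^ n ≤ 4 := by
    calc (1 + 1 / (n : ℝ)) ^ n ≤ Real.exp (1 / n) ^ n := by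
          gcongr
          rw [add_comm]; exact Real.add_one_le_exp _
      _ = Real.exp 1 := by rw [← Real.exp_nat_mul]; congr 1; field_simp
      _ ≤ 4 := by linarith [Real.exp_one_lt_d9]
  rw [h2, inv_pow]
  calc (1 / 2 : ℝ) ^ 2 = 4⁻¹ := by norm_num
    _ ≤ _ := by gcongr

variable {d : ℕ}

/-- The part of the unit ball in a slab is small: it is mapped into the ball by a linear map of
large determinant. -/
theorem volume_slab_le (v : OrthonormalBasis (Fin d) ℝ (EuclideanSpace ℝ (Fin d))) (i : Fin d)
    {δ : ℝ} (hδ : 0 < δ) :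
    volume {x : EuclideanSpace ℝ (Fin d) | ‖x‖ ≤ 1 ∧ inner ℝ (v i) x ^ 2 ≤ δ ^ 2 / (4 * d)} ≤
      ENNReal.ofReal δ * volume (Metric.ball (0 : EuclideanSpace ℝ (Fin d)) 1) := by
  have hd : 0 < d := i.pos
  have hd' : (1 : ℝ) ≤ d := by exact_mod_cast hd
  have hq : (0 : ℝ) ≤ 1 - 1 / d := by
    rw [sub_nonneg, div_le_one (by linarith)]; exact hd'
  -- Stretching by `2/δ` across the slab uses up `1/d` of the squared norm; contracting the other `d
  -- - 1` directions by `√(1 - 1/d)` makes room for it, yet costs at most a factor 2 in volume.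
  set c : Fin d → ℝ := fun j => if j = i then 2 / δ else Real.sqrt (1 - 1 / d) with hc
  set M := Matrix.toLin v.toBasis v.toBasis (Matrix.diagonal c) with hM
  set A : EuclideanSpace ℝ (Fin d) →L[ℝ] EuclideanSpace ℝ (Fin d) :=
    LinearMap.toContinuousLinearMap M with hA
  have hv : ∀ j, A (v j) = c j • v j := fun j => by
    have := Matrix.toLin_self v.toBasis v.toBasis (Matrix.diagonal c) j
    rw [OrthonormalBasis.coe_toBasis] at this
    simp only [hA, LinearMap.coe_toContinuousLinearMap', hM, this]
    rw [Finset.sum_eq_single j]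
    · simp
    · intro k _ hk; simp [Matrix.diagonal_apply_ne _ hk]
    · simp
  have hdet : 1 / δ ≤ LinearMap.det M := by
    rw [hM, LinearMap.det_toLin, Matrix.det_diagonal, hc,
      ← Finset.mul_prod_erase _ _ (Finset.mem_univ i)]
    rw [Finset.prod_congr rfl (g := fun _ => Real.sqrt (1 - 1 / d))
      (fun j hj => if_neg (Finset.ne_of_mem_erase hj))]
    rw [Finset.prod_const, Finset.card_erase_of_mem (Finset.mem_univ i), Finset.card_univ,
      Fintype.card_fin, if_pos rfl]
    have h1 := half_le_sqrt_pow (d - 1)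
    rw [Nat.cast_sub hd, Nat.cast_one, sub_add_cancel] at h1
    calc 1 / δ = 2 / δ * (1 / 2) := by ring
      _ ≤ _ := by gcongr
  set W := {x : EuclideanSpace ℝ (Fin d) | ‖x‖ ≤ 1 ∧ inner ℝ (v i) x ^ 2 ≤ δ ^ 2 / (4 * d)} with hW
  have himg : M '' W ⊆ Metric.closedBall 0 1 := by
    rintro _ ⟨x, ⟨hx1, hx2⟩, rfl⟩
    rw [mem_closedBall_zero_iff]
    apply le_of_sq_le_sq _ zero_le_one
    have h1 : ‖M x‖ ^ 2 = ∑ j, c j ^ 2 * inner ℝ (v j) x ^ 2 := by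
      rw [norm_sq_eq_sum v]
      refine Finset.sum_congr rfl fun j _ => ?_
      rw [← mul_pow, ← inner_eigenvector_apply hv]
      rfl
    have h2 : ‖x‖ ^ 2 ≤ 1 := pow_le_one₀ (norm_nonneg _) hx1
    rw [norm_sq_eq_sum v] at h2
    rw [h1]
    have h3 : ∀ j, c j ^ 2 * inner ℝ (v j) x ^ 2 ≤
        (1 - 1 / d) * inner ℝ (v j) x ^ 2 + if j = i then 1 / (d : ℝ) else 0 := fun j => by
      by_cases hj : j = i
      · subst hj
        simp only [hc, if_pos]
        have h4 : (2 / δ) ^ 2 * inner ℝ (v j) x ^ 2 ≤ (2 / δ) ^ 2 * (δ ^ 2 / (4 * d)) := by gcongr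
        have h5 : (2 / δ) ^ 2 * (δ ^ 2 / (4 * d)) = 1 / (d : ℝ) := by field_simp; norm_num
        have h6 := mul_nonneg hq (sq_nonneg (inner ℝ (v j) x))
        linarith
      · simp only [hc, if_neg hj, Real.sq_sqrt hq]
        linarith
    calc _ ≤ ∑ j, ((1 - 1 / d) * inner ℝ (v j) x ^ 2 + if j = i then 1 / (d : ℝ) else 0) :=
          Finset.sum_le_sum fun j _ => h3 j
      _ = (1 - 1 / d) * ∑ j, inner ℝ (v j) x ^ 2 + 1 / d := by
          rw [Finset.sum_add_distrib, Finset.mul_sum]; simp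
      _ ≤ (1 - 1 / d) * 1 + 1 / d := by gcongr
      _ = 1 ^ 2 := by ring
  have : Nontrivial (EuclideanSpace ℝ (Fin d)) :=
    Module.nontrivial_of_finrank_pos (R := ℝ) (by simpa using hd)
  have h1 := measure_mono (μ := volume) himg
  rw [Measure.addHaar_image_linearMap, Measure.addHaar_closedBall_eq_addHaar_ball] at h1
  have h2 : ENNReal.ofReal (1 / δ) * volume W ≤ volume (Metric.ball (0 : EuclideanSpace ℝ (Fin d)) 1) :=
    le_trans (by gcongr; exact hdet.trans (le_abs_self _)) h1
  calc volume W = ENNReal.ofReal δ * (ENNReal.ofReal (1 / δ) * volume W) := by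
        rw [← mul_assoc, ← ENNReal.ofReal_mul hδ.le, mul_one_div_cancel hδ.ne', ENNReal.ofReal_one,
          one_mul]
    _ ≤ _ := by gcongr

open scoped Pointwise in
/-- Anti-concentration of a coordinate of a uniformly distributed unit vector. -/
theorem uniformSphere_inner_sq_lt_le (v : OrthonormalBasis (Fin d) ℝ (EuclideanSpace ℝ (Fin d)))
    (i : Fin d) {δ : ℝ} (hδ : 0 < δ) :
    uniformSphere d {u | inner ℝ (v i) (u : EuclideanSpace ℝ (Fin d)) ^ 2 < δ ^ 2 / (4 * d)} ≤
      ENNReal.ofReal δ := by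
  have : Nontrivial (EuclideanSpace ℝ (Fin d)) :=
    Module.nontrivial_of_finrank_pos (R := ℝ) (by simp [i.pos])
  set S : Set (Metric.sphere (0 : EuclideanSpace ℝ (Fin d)) 1) :=
    {u | inner ℝ (v i) (u : EuclideanSpace ℝ (Fin d)) ^ 2 < δ ^ 2 / (4 * d)} with hS
  have hSm : MeasurableSet S := by
    apply IsOpen.measurableSet
    exact isOpen_lt (by fun_prop) continuous_const
  -- The surface measure of `S` is `d` times the volume of the cone over it, and that cone lies in
  -- the slab.
  have hsub : Set.Ioo (0 : ℝ) 1 • ((↑) '' S : Set (EuclideanSpace ℝ (Fin d))) ⊆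
      {x | ‖x‖ ≤ 1 ∧ inner ℝ (v i) x ^ 2 ≤ δ ^ 2 / (4 * d)} := by
    rintro _ ⟨c, hc, _, ⟨u, hu, rfl⟩, rfl⟩
    have hn : ‖(u : EuclideanSpace ℝ (Fin d))‖ = 1 := by simp
    refine ⟨?_, ?_⟩
    · change ‖c • (u : EuclideanSpace ℝ (Fin d))‖ ≤ 1
      rw [norm_smul, hn, mul_one, Real.norm_eq_abs, abs_of_pos hc.1]; exact hc.2.le
    · change inner ℝ (v i) (c • (u : EuclideanSpace ℝ (Fin d))) ^ 2 ≤ _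
      rw [inner_smul_right, mul_pow]
      have h1 : c ^ 2 ≤ 1 := pow_le_one₀ hc.1.le hc.2.le
      exact (mul_le_of_le_one_left (sq_nonneg _) h1).trans (le_of_lt hu)
  have h1 : (volume : Measure (EuclideanSpace ℝ (Fin d))).toSphere S ≤ ENNReal.ofReal δ *
      (volume : Measure (EuclideanSpace ℝ (Fin d))).toSphere Set.univ := by
    rw [Measure.toSphere_apply' _ hSm, Measure.toSphere_apply_univ, mul_left_comm]
    gcongr
    exact (measure_mono hsub).trans (volume_slab_le v i hδ)
  rw [uniformSphere, Measure.smul_apply, smul_eq_mul]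
  rw [mul_comm, ← div_eq_mul_inv]
  exact ENNReal.div_le_of_le_mul h1

end Sphere

/-! ### The lucky event -/

section Events

variable {d : ℕ}

/-- Pairs of a point and a direction for which the joint Krylov subspace of order `T` contains a
point at which the cubic model is less than `θ`. -/
def lowPairs (g : EuclideanSpace ℝ (Fin d) → ℝ) (ρ : ℝ) (T : ℕ) (θ : ℝ) :
    Set (EuclideanSpace ℝ (Fin d) × Metric.sphere (0 : EuclideanSpace ℝ (Fin d)) 1) :=
  {p | ∃ x ∈ krylov T (hessian g p.1) {∇ g p.1, (p.2 : EuclideanSpace ℝ (Fin d))},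
    cubicModel (hessian g p.1) (∇ g p.1) ρ x < θ}

theorem mem_krylov_pair {A : EuclideanSpace ℝ (Fin d) →L[ℝ] EuclideanSpace ℝ (Fin d)}
    {b u x : EuclideanSpace ℝ (Fin d)} {t : ℕ} :
    x ∈ krylov t A {b, u} ↔ ∃ c c' : Fin t → ℝ,
      x = ∑ j, (c j • (A ^ (j : ℕ)) b + c' j • (A ^ (j : ℕ)) u) := by
  constructor
  · intro hx
    induction hx using Submodule.span_induction with
    | mem x h =>
      obtain ⟨j, hj, w, rfl | rfl, rfl⟩ := h
      · exact ⟨Pi.single ⟨j, hj⟩ 1, 0, by simp [Pi.single_apply, ite_smul]⟩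
      · exact ⟨0, Pi.single ⟨j, hj⟩ 1, by simp [Pi.single_apply, ite_smul]⟩
    | zero => exact ⟨0, 0, by simp⟩
    | add x y _ _ hx hy =>
      obtain ⟨c, c', rfl⟩ := hx
      obtain ⟨e, e', rfl⟩ := hy
      refine ⟨c + e, c' + e', ?_⟩
      rw [← Finset.sum_add_distrib]
      refine Finset.sum_congr rfl fun j _ => ?_
      simp only [Pi.add_apply, add_smul]
      abel
    | smul k x _ hx =>
      obtain ⟨c, c', rfl⟩ := hx
      refine ⟨k • c, k • c', ?_⟩
      rw [Finset.smul_sum]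
      refine Finset.sum_congr rfl fun j _ => ?_
      simp [smul_smul]
  · rintro ⟨c, c', rfl⟩
    refine Submodule.sum_mem _ fun j _ => Submodule.add_mem _ ?_ ?_
    · exact Submodule.smul_mem _ _ (Submodule.subset_span ⟨j, j.2, b, Or.inl rfl, rfl⟩)
    · exact Submodule.smul_mem _ _ (Submodule.subset_span ⟨j, j.2, u, Or.inr rfl, rfl⟩)

/-- For fixed coefficients of the Krylov combination the model value is continuous in the pair, so
the set is a union of open sets. Measurability thus needs no measurable choice of eigenvectors or
minimizers. -/
theorem isOpen_lowPairs {g : EuclideanSpace ℝ (Fin d) → ℝ} {β ρ : ℝ} (h : SmoothObjective g β ρ)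
    (hρ : 0 ≤ ρ) (T : ℕ) (θ : ℝ) : IsOpen (lowPairs g ρ T θ) := by
  have hH := h.continuous_hessian hρ
  have hG : Continuous (∇ g) := h.differentiable_gradient.continuous
  have heq : lowPairs g ρ T θ = ⋃ (c : Fin T → ℝ) (c' : Fin T → ℝ),
      {p | cubicModel (hessian g p.1) (∇ g p.1) ρ (∑ j, (c j • (hessian g p.1 ^ (j : ℕ)) (∇ g p.1) +
        c' j • (hessian g p.1 ^ (j : ℕ)) (p.2 : EuclideanSpace ℝ (Fin d)))) < θ} := by
    ext p
    simp only [lowPairs, Set.mem_ofPred_eq, Set.mem_iUnion, mem_krylov_pair]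
    constructor
    · rintro ⟨_, ⟨c, c', rfl⟩, hx⟩; exact ⟨c, c', hx⟩
    · rintro ⟨c, c', hx⟩; exact ⟨_, ⟨c, c', rfl⟩, hx⟩
  rw [heq]
  refine isOpen_iUnion fun c => isOpen_iUnion fun c' => isOpen_lt ?_ continuous_const
  have hH1 : Continuous fun p : EuclideanSpace ℝ (Fin d) ×
      Metric.sphere (0 : EuclideanSpace ℝ (Fin d)) 1 => hessian g p.1 := hH.comp continuous_fst
  have hG1 : Continuous fun p : EuclideanSpace ℝ (Fin d) ×
      Metric.sphere (0 : EuclideanSpace ℝ (Fin d)) 1 => ∇ g p.1 := hG.comp continuous_fst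
  have hx : Continuous fun p : EuclideanSpace ℝ (Fin d) ×
      Metric.sphere (0 : EuclideanSpace ℝ (Fin d)) 1 =>
      ∑ j, (c j • (hessian g p.1 ^ (j : ℕ)) (∇ g p.1) +
        c' j • (hessian g p.1 ^ (j : ℕ)) (p.2 : EuclideanSpace ℝ (Fin d))) := by
    refine continuous_finsetSum _ fun j _ => ?_
    have h1 := (hH1.pow j).clm_apply hG1
    have h2 := (hH1.pow j).clm_apply (continuous_subtype_val.comp continuous_snd)
    exact (h1.const_smul (c j)).add (h2.const_smul (c' j))
  unfold cubicModel quadModel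
  exact (((hx.inner (hH1.clm_apply hx)).const_mul _).add (hG1.inner hx)).add
    ((hx.norm.pow 3).const_mul _)

/-- Pairs without a point of low value whose first component admits such a point for most
directions. -/
def unluckyPairs (g : EuclideanSpace ℝ (Fin d) → ℝ) (ρ : ℝ) (T : ℕ) (θ δ : ℝ) :
    Set (EuclideanSpace ℝ (Fin d) × Metric.sphere (0 : EuclideanSpace ℝ (Fin d)) 1) :=
  (lowPairs g ρ T θ)ᶜ ∩
    {p | uniformSphere d (Prod.mk p.1 ⁻¹' (lowPairs g ρ T θ)ᶜ) ≤ ENNReal.ofReal δ}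

/-- By independence the joint law is a product. For each fixed point the section of the unlucky set
is either empty or of measure at most `δ`, so Fubini gives the bound. -/
theorem prob_mem_unluckyPairs_le {Ω : Type*} [MeasurableSpace Ω] {P : Measure Ω}
    [IsProbabilityMeasure P] {g : EuclideanSpace ℝ (Fin d) → ℝ} {β ρ : ℝ}
    (h : SmoothObjective g β ρ) (hρ : 0 ≤ ρ) (T : ℕ) (θ δ : ℝ)
    {Y : Ω → EuclideanSpace ℝ (Fin d)} {U : Ω → Metric.sphere (0 : EuclideanSpace ℝ (Fin d)) 1}
    (hY : Measurable Y) (hU : HasLaw U (uniformSphere d) P) (hind : IndepFun Y U P) :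
    P {ω | (Y ω, U ω) ∈ unluckyPairs g ρ T θ δ} ≤ ENNReal.ofReal δ := by
  have hσ : IsProbabilityMeasure (uniformSphere d) := by
    rw [← hU.map_eq]; exact Measure.isProbabilityMeasure_map hU.aemeasurable
  have hμ : IsProbabilityMeasure (P.map Y) := Measure.isProbabilityMeasure_map hY.aemeasurable
  have hlow : MeasurableSet (lowPairs g ρ T θ)ᶜ := (isOpen_lowPairs h hρ T θ).measurableSet.compl
  have hD : MeasurableSet (unluckyPairs g ρ T θ δ) :=
    hlow.inter (((measurable_measure_prodMk_left hlow).comp measurable_fst) measurableSet_Iic)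
  have hmap := (indepFun_iff_map_prod_eq_prod_map_map hY.aemeasurable hU.aemeasurable).1 hind
  rw [hU.map_eq] at hmap
  have h1 : P {ω | (Y ω, U ω) ∈ unluckyPairs g ρ T θ δ} =
      P.map (fun ω => (Y ω, U ω)) (unluckyPairs g ρ T θ δ) :=
    (Measure.map_apply_of_aemeasurable (hY.aemeasurable.prodMk hU.aemeasurable) hD).symm
  rw [h1, hmap, Measure.prod_apply hD]
  calc _ ≤ ∫⁻ _, ENNReal.ofReal δ ∂(P.map Y) := by
        refine lintegral_mono fun x => ?_
        by_cases hx : uniformSphere d (Prod.mk x ⁻¹' (lowPairs g ρ T θ)ᶜ) ≤ ENNReal.ofReal δ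
        · exact (measure_mono fun u hu => hu.1).trans hx
        · have : Prod.mk x ⁻¹' unluckyPairs g ρ T θ δ = ∅ := by
            ext u; simp only [Set.mem_preimage, Set.mem_empty_iff_false, iff_false]
            exact fun hu => hx hu.2
          rw [this]; simp
    _ = _ := by simp

theorem tsum_callConfidence_le {δ : ℝ} (hδ : 0 < δ) :
    ∑' k, ENNReal.ofReal (callConfidence δ k) ≤ ENNReal.ofReal δ := by
  have h1 : HasSum (fun n : ℕ => (1 : ℝ) / ((n : ℝ) + 1) ^ 2) (Real.pi ^ 2 / 6) := by
    have := (hasSum_nat_add_iff' 1).2 hasSum_zeta_two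
    simpa using this
  have h2 : HasSum (callConfidence δ) (δ / 2 * (Real.pi ^ 2 / 6)) := by
    have h3 : callConfidence δ = fun n : ℕ => δ / 2 * (1 / ((n : ℝ) + 1) ^ 2) := by
      funext n
      unfold callConfidence
      field_simp
    rw [h3]
    exact h1.mul_left _
  rw [← ENNReal.ofReal_tsum_of_nonneg (fun n => by unfold callConfidence; positivity) h2.summable,
    h2.tsum_eq]
  apply ENNReal.ofReal_le_ofReal
  have := Real.pi_lt_d2
  have := Real.pi_pos
  have h4 : Real.pi ^ 2 ≤ 12 := by nlinarith
  nlinarith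

/-- The event that no step of the run is unlucky. -/
theorem exists_lucky_event {Ω : Type*} [MeasurableSpace Ω] {P : Measure Ω}
    [IsProbabilityMeasure P] {g : EuclideanSpace ℝ (Fin d) → ℝ} {β ρ ε δ : ℝ}
    {y₀ : EuclideanSpace ℝ (Fin d)}
    {U : ℕ → Ω → Metric.sphere (0 : EuclideanSpace ℝ (Fin d)) 1}
    {y : ℕ → Ω → EuclideanSpace ℝ (Fin d)}
    (h : SmoothObjective g β ρ) (hρ : 0 ≤ ρ) (hδ : 0 < δ)
    (hrun : IsMajorizationRun P g β ρ ε δ y₀ U y) (T : ℕ → ℕ) (θ : ℝ) :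
    ∃ G : Set Ω, MeasurableSet G ∧ ENNReal.ofReal (1 - δ) ≤ P G ∧
      ∀ ω ∈ G, ∀ k, (y k ω, U k ω) ∉ unluckyPairs g ρ (T k) θ (callConfidence δ k) := by
  -- `HasLaw` provides only a.e. measurability of the directions, so measurable hulls of the unlucky
  -- events are used.
  set B : ℕ → Set Ω := fun k =>
    toMeasurable P {ω | (y k ω, U k ω) ∈ unluckyPairs g ρ (T k) θ (callConfidence δ k)} with hB
  have hBm : MeasurableSet (⋃ k, B k) := MeasurableSet.iUnion fun k => measurableSet_toMeasurable _ _
  have hBP : P (⋃ k, B k) ≤ ENNReal.ofReal δ := by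
    refine (measure_iUnion_le _).trans (le_trans (ENNReal.tsum_le_tsum fun k => ?_)
      (tsum_callConfidence_le hδ))
    rw [hB, measure_toMeasurable]
    refine prob_mem_unluckyPairs_le h hρ _ _ _ (hrun.measurable k) (hrun.uniform k) ?_
    exact (hrun.fresh k).comp (measurable_pi_apply (Fin.last k)) measurable_id
  refine ⟨(⋃ k, B k)ᶜ, hBm.compl, ?_, fun ω hω k hk => hω ?_⟩
  · rw [prob_compl_eq_one_sub hBm, ENNReal.ofReal_sub _ hδ.le, ENNReal.ofReal_one]
    gcongr
  · exact Set.mem_iUnion.2 ⟨k, subset_toMeasurable _ _ hk⟩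

/-- A lucky step without progress is followed by a successful final step. -/
theorem finalPoints_of_not_makesProgress {g : EuclideanSpace ℝ (Fin d) → ℝ} {β ρ ε δ : ℝ}
    (h : SmoothObjective g β ρ) (hβ : 0 < β) (hρ : 0 < ρ) (hε : 0 < ε) (hδ : 0 < δ)
    (hεβ : ε ≤ β ^ 2 / ρ) {y Δ : EuclideanSpace ℝ (Fin d)}
    {u : Metric.sphere (0 : EuclideanSpace ℝ (Fin d)) 1}
    (hu : (y, u) ∉ unluckyPairs g ρ (innerSteps d ρ β (stepRadius ρ ε) δ)
      (-(1 / 12 * ρ * stepRadius ρ ε ^ 3)) δ)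
    (hΔ : Δ ∈ solveCR (hessian g y) (∇ g y) ρ β (stepRadius ρ ε) δ u)
    (hprog : ¬ MakesProgress g ρ ε y (y + Δ)) :
    (finalPoints g β ρ ε y).Nonempty ∧
      ∀ z ∈ finalPoints g β ρ ε y, IsSecondOrderStationary g ρ ε z := by
  have hr : 0 < stepRadius ρ ε := Real.sqrt_pos.2 (by positivity)
  have hrβ : 3 * (ρ * stepRadius ρ ε) ≤ β := by
    apply le_of_sq_le_sq _ hβ.le
    rw [mul_pow, mul_pow, stepRadius, Real.sq_sqrt (by positivity)]
    rw [le_div_iff₀ hρ] at hεβ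
    calc _ = ε * ρ := by field_simp; norm_num
      _ ≤ _ := hεβ
  have hnl : (y, u) ∉ lowPairs g ρ (innerSteps d ρ β (stepRadius ρ ε) δ)
      (-(1 / 12 * ρ * stepRadius ρ ε ^ 3)) := by
    rintro ⟨x, hx, hxc⟩
    apply hprog
    have h1 := h.le_add_cubicModel y Δ
    have h2 := hΔ.2 x hx
    unfold MakesProgress
    linarith
  rcases low_cubicModel_or_solveQuadratic (h.isSymmetric_hessian y) (h.norm_hessian_le hβ.le y) hβ
    hρ hr hδ hrβ (show 0 < 2 * ε / 3 by positivity) (∇ g y) with ⟨v, i, hv⟩ | hall | ⟨hne, hcurv, hfin⟩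
  -- Every direction without a low point has a small component along `v i`. These directions have
  -- measure at most `δ`, so the pair would be unlucky.
  · refine absurd ⟨hnl, ?_⟩ hu
    refine le_trans (measure_mono fun w hw => ?_) (uniformSphere_inner_sq_lt_le v i hδ)
    by_contra hw'
    exact hw (hv w (by simp) (not_lt.1 hw'))
  · exact absurd (hall u) hnl
  · refine ⟨?_, ?_⟩
    · obtain ⟨x, hx⟩ := hne
      exact ⟨y + x, x, hx, rfl⟩
    · rintro _ ⟨x, hx, rfl⟩
      obtain ⟨h1, h2⟩ := hfin x hx
      exact h.isSecondOrderStationary_add hρ hε h1 h2 hcurv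

end Events

/-! ### Counting oracle queries -/

section Counting

namespace OracleProg

variable {E α γ : Type*}

theorem gradCount_bind (ans : OracleQuery E → E) (p : OracleProg E α) (f : α → OracleProg E γ) :
    (p.bind f).gradCount ans = p.gradCount ans + (f (p.result ans)).gradCount ans := by
  induction p with
  | done a => simp [bind, gradCount, result]
  | ask q next ih =>
    cases q with
    | grad y => simp only [bind, gradCount, result, ih]; omega
    | hvp y v => simp only [bind, gradCount, result, ih]

theorem hvpCount_bind (ans : OracleQuery E → E) (p : OracleProg E α) (f : α → OracleProg E γ) :
    (p.bind f).hvpCount ans = p.hvpCount ans + (f (p.result ans)).hvpCount ans := by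
  induction p with
  | done a => simp [bind, hvpCount, result]
  | ask q next ih =>
    cases q with
    | grad y => simp only [bind, hvpCount, result, ih]
    | hvp y v => simp only [bind, hvpCount, result, ih]; omega

end OracleProg

open OracleProg

variable {E : Type*} (ans : OracleQuery E → E)

theorem gradCount_krylovProg (y : E) (t : ℕ) (v : E) : (krylovProg y t v).gradCount ans = 0 := by
  induction t generalizing v with
  | zero => rfl
  | succ t ih => simp [krylovProg, gradCount, gradCount_bind, ih]

theorem hvpCount_krylovProg (y : E) (t : ℕ) (v : E) : (krylovProg y t v).hvpCount ans = t := by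
  induction t generalizing v with
  | zero => rfl
  | succ t ih => simp [krylovProg, hvpCount, hvpCount_bind, ih]

theorem gradCount_iterationsProg (y u : ℕ → E) (T : ℕ → ℕ) (k : ℕ) :
    (iterationsProg y u T k).gradCount ans = k + 1 := by
  induction k with
  | zero =>
    simp [iterationsProg, solveCRProg, gradCount, gradCount_bind, gradCount_krylovProg]
  | succ k ih =>
    simp [iterationsProg, solveCRProg, gradCount, gradCount_bind, gradCount_krylovProg, ih]

theorem hvpCount_iterationsProg (y u : ℕ → E) (T : ℕ → ℕ) (k : ℕ) :
    (iterationsProg y u T k).hvpCount ans = ∑ j ∈ Finset.range (k + 1), 2 * T j := by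
  induction k with
  | zero =>
    simp [iterationsProg, solveCRProg, hvpCount, hvpCount_bind, hvpCount_krylovProg]
    omega
  | succ k ih =>
    rw [Finset.sum_range_succ, ← ih]
    simp [iterationsProg, solveCRProg, hvpCount, hvpCount_bind, hvpCount_krylovProg]
    omega

variable {d : ℕ} (g : EuclideanSpace ℝ (Fin d) → ℝ) (β ρ ε δ : ℝ)
  (y u : ℕ → EuclideanSpace ℝ (Fin d)) (k : ℕ)

theorem gradEvals_eq : gradEvals g β ρ ε δ y u k = k + 1 := by
  simp [gradEvals, executionProg, gradCount_bind, gradCount_iterationsProg, gradCount_krylovProg]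

theorem hvpEvals_eq : hvpEvals g β ρ ε δ y u k =
    ∑ j ∈ Finset.range (k + 1), 2 * innerSteps d ρ β (stepRadius ρ ε) (callConfidence δ j) +
      finalSteps ρ β (stepRadius ρ ε) (2 * ε / 3) := by
  simp [hvpEvals, executionProg, hvpCount_bind, hvpCount_iterationsProg, hvpCount_krylovProg]

end Counting

/-! ### Iteration and oracle complexity -/

section Complexity

theorem natCeil_le_of_le {x B : ℝ} (h : x ≤ B) (hB : 0 ≤ B) : (⌈x⌉₊ : ℝ) ≤ B + 1 :=
  (Nat.cast_le.2 (Nat.ceil_mono h)).trans (Nat.ceil_lt_add_one hB).le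

theorem stepRadius_pow_four {p q : ℝ} (hp : 0 < p) :
    stepRadius (p ^ 4) (q ^ 4) = q ^ 2 / (3 * p ^ 2) := by
  rw [stepRadius, show q ^ 4 / (9 * p ^ 4) = (q ^ 2 / (3 * p ^ 2)) ^ 2 by field_simp; norm_num]
  exact Real.sqrt_sq (by positivity)

/-- At this radius `24β/(ρr)` is `72S²`, and `72(4 + ℓ²/2) ≤ (17 + 7ℓ)²`; rounding up adds 1,
absorbed by `S ≥ 1`. -/
theorem innerSteps_le {d : ℕ} {p q w δ S : ℝ} (hp : 0 < p) (hq : 0 < q)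
    (hS : S = w / (p * q)) (hS1 : 1 ≤ S) (hℓ : 0 ≤ Real.log (4 * d / δ ^ 2)) :
    (innerSteps d (p ^ 4) (w ^ 2) (stepRadius (p ^ 4) (q ^ 4)) δ : ℝ) ≤
      S * (18 + 7 * Real.log (4 * d / δ ^ 2)) := by
  set ℓ := Real.log (4 * d / δ ^ 2) with hℓ'
  have h1 : 24 * w ^ 2 / (p ^ 4 * stepRadius (p ^ 4) (q ^ 4)) * (4 + 1 / 2 * ℓ ^ 2) ≤
      (S * (17 + 7 * ℓ)) ^ 2 := by
    have : 24 * w ^ 2 / (p ^ 4 * stepRadius (p ^ 4) (q ^ 4)) = 72 * S ^ 2 := by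
      rw [stepRadius_pow_four hp, hS]; field_simp; ring
    rw [this, mul_pow, mul_comm 72, mul_assoc]
    gcongr
    nlinarith
  have h2 : Real.sqrt (24 * w ^ 2 / (p ^ 4 * stepRadius (p ^ 4) (q ^ 4)) * (4 + 1 / 2 * ℓ ^ 2)) ≤
      S * (17 + 7 * ℓ) := Real.sqrt_le_iff.2 ⟨by positivity, h1⟩
  have h3 := natCeil_le_of_le h2 (by positivity)
  unfold innerSteps
  linarith

/-- The condition number is `3S² + 2`, and with `ε_g = 2ε/3` the argument of the logarithm is
exactly its square. -/
theorem finalSteps_le {p q w S : ℝ} (hp : 0 < p) (hq : 0 < q) (hw : 0 < w)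
    (hS : S = w / (p * q)) (hS1 : 1 ≤ S) :
    (finalSteps (p ^ 4) (w ^ 2) (stepRadius (p ^ 4) (q ^ 4)) (2 * q ^ 4 / 3) : ℝ) ≤
      S * (19 + 3 * Real.log S) := by
  have hlS : 0 ≤ Real.log S := Real.log_nonneg hS1
  have hw' : w = S * (p * q) := by rw [hS]; field_simp
  have h1 : Real.sqrt ((w ^ 2 + 2 * p ^ 4 * stepRadius (p ^ 4) (q ^ 4)) /
      (p ^ 4 * stepRadius (p ^ 4) (q ^ 4))) ≤ 3 * S := by
    rw [Real.sqrt_le_iff]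
    refine ⟨by positivity, ?_⟩
    rw [stepRadius_pow_four hp, hw']
    have : ((S * (p * q)) ^ 2 + 2 * p ^ 4 * (q ^ 2 / (3 * p ^ 2))) /
        (p ^ 4 * (q ^ 2 / (3 * p ^ 2))) = 3 * S ^ 2 + 2 := by field_simp
    rw [this]; nlinarith
  have h2 : Real.log (36 * (w ^ 2 + 2 * p ^ 4 * stepRadius (p ^ 4) (q ^ 4)) ^ 2 *
      stepRadius (p ^ 4) (q ^ 4) ^ 2 / (2 * q ^ 4 / 3) ^ 2) ≤ 24 + 4 * Real.log S := by
    rw [stepRadius_pow_four hp, hw']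
    have : 36 * ((S * (p * q)) ^ 2 + 2 * p ^ 4 * (q ^ 2 / (3 * p ^ 2))) ^ 2 *
        (q ^ 2 / (3 * p ^ 2)) ^ 2 / (2 * q ^ 4 / 3) ^ 2 = (3 * S ^ 2 + 2) ^ 2 := by
      field_simp; ring
    rw [this]
    have h3 : (3 * S ^ 2 + 2) ^ 2 ≤ 25 * S ^ 4 := by
      have : 3 * S ^ 2 + 2 ≤ 5 * S ^ 2 := by nlinarith
      calc _ ≤ (5 * S ^ 2) ^ 2 := by gcongr
        _ = _ := by ring
    refine (Real.log_le_log (by positivity) h3).trans ?_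
    rw [Real.log_mul (by norm_num) (by positivity), Real.log_pow]
    have := Real.log_le_sub_one_of_pos (show (0 : ℝ) < 25 by norm_num)
    push_cast
    linarith
  have h3 : 1 / 4 * Real.sqrt ((w ^ 2 + 2 * p ^ 4 * stepRadius (p ^ 4) (q ^ 4)) /
      (p ^ 4 * stepRadius (p ^ 4) (q ^ 4))) * Real.log (36 * (w ^ 2 + 2 * p ^ 4 *
      stepRadius (p ^ 4) (q ^ 4)) ^ 2 * stepRadius (p ^ 4) (q ^ 4) ^ 2 / (2 * q ^ 4 / 3) ^ 2) ≤
      1 / 4 * (3 * S) * (24 + 4 * Real.log S) := by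
    refine (mul_le_mul_of_nonneg_left h2 (by positivity)).trans ?_
    gcongr
  have h4 := natCeil_le_of_le h3 (by positivity)
  unfold finalSteps
  linarith

theorem log_callConfidence {d : ℕ} (hd : 0 < d) {δ : ℝ} (hδ : 0 < δ) (j : ℕ) :
    Real.log (4 * d / callConfidence δ j ^ 2) =
      Real.log 16 + 4 * Real.log ((j : ℝ) + 1) + Real.log (d / δ ^ 2) := by
  have hd' : (0 : ℝ) < d := by exact_mod_cast hd
  have : 4 * d / callConfidence δ j ^ 2 = 16 * ((j : ℝ) + 1) ^ 4 * (d / δ ^ 2) := by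
    unfold callConfidence; field_simp; norm_num
  rw [this, Real.log_mul (by positivity) (by positivity), Real.log_mul (by norm_num) (by positivity),
    Real.log_pow]
  norm_num

/-- Each step with progress spends a fixed amount of the finite gap `g (y 0) - inf g`. This holds
for every sequence, with no probability involved. -/
theorem exists_stopsAt {d : ℕ} {g : EuclideanSpace ℝ (Fin d) → ℝ} (hg : BddBelow (Set.range g))
    {ρ ε : ℝ} (hρ : 0 < ρ) (hε : 0 < ε) (y : ℕ → EuclideanSpace ℝ (Fin d)) :
    ∃ k, StopsAt g ρ ε y k ∧
      k * (1 / 12 * ρ * stepRadius ρ ε ^ 3) ≤ g (y 0) - ⨅ x, g x := by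
  have hr : 0 < stepRadius ρ ε := Real.sqrt_pos.2 (by positivity)
  have hc : 0 < 1 / 12 * ρ * stepRadius ρ ε ^ 3 := by positivity
  have hdec : ∀ n : ℕ, (∀ j < n, MakesProgress g ρ ε (y j) (y (j + 1))) →
      n * (1 / 12 * ρ * stepRadius ρ ε ^ 3) ≤ g (y 0) - ⨅ x, g x := by
    intro n hn
    have h1 : g (y n) ≤ g (y 0) - n * (1 / 12 * ρ * stepRadius ρ ε ^ 3) := by
      induction n with
      | zero => simp
      | succ n ih =>
        have h2 := ih fun j hj => hn j (by omega)
        have h3 : g (y (n + 1)) ≤ g (y n) - 1 / 12 * ρ * stepRadius ρ ε ^ 3 := hn n (by omega)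
        push_cast
        linarith
    have := ciInf_le hg (y n)
    linarith
  have hex : ∃ k, ¬ MakesProgress g ρ ε (y k) (y (k + 1)) := by
    by_contra hall
    push Not at hall
    obtain ⟨n, hn⟩ := exists_nat_gt ((g (y 0) - ⨅ x, g x) / (1 / 12 * ρ * stepRadius ρ ε ^ 3))
    rw [div_lt_iff₀ hc] at hn
    exact absurd (hdec n fun j _ => hall j) (not_le.2 hn)
  classical
  have hmin : ∀ j < Nat.find hex, MakesProgress g ρ ε (y j) (y (j + 1)) := fun j hj =>
    not_not.1 (Nat.find_min hex hj)
  exact ⟨Nat.find hex, ⟨hmin, Nat.find_spec hex⟩, hdec _ hmin⟩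

/-- The oracle complexity of an execution, in terms of the fourth roots `p`, `q` of `ρ`, `ε` and
the square root `w` of `β`. -/
theorem complexity_bounds {d : ℕ} (hd : 0 < d) (g : EuclideanSpace ℝ (Fin d) → ℝ)
    {p q w D δ : ℝ} (hp : 0 < p) (hq : 0 < q) (hw : 0 < w) (hδ : 0 < δ) (hδ1 : δ ≤ 1)
    (hpq : p * q ≤ w) (hD : q ^ 6 ≤ p ^ 2 * D) (y u : ℕ → EuclideanSpace ℝ (Fin d)) {k : ℕ}
    (hk : k * (1 / 12 * p ^ 4 * stepRadius (p ^ 4) (q ^ 4) ^ 3) ≤ D) :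
    (hvpEvals g (w ^ 2) (p ^ 4) (q ^ 4) δ y u k : ℝ) ≤ 6000000 * (w * p * D / q ^ 7) *
      (1 + Real.log (d / δ ^ 2) + Real.log (w * p * D / q ^ 7)) ∧
    ((k + 1 : ℕ) : ℝ) ≤ 6000000 * (p ^ 2 * D / q ^ 6) := by
  obtain ⟨S, hS⟩ : ∃ S, S = w / (p * q) := ⟨_, rfl⟩
  obtain ⟨N, hN⟩ : ∃ N, N = p ^ 2 * D / q ^ 6 := ⟨_, rfl⟩
  have hS1 : 1 ≤ S := by rw [hS, one_le_div (by positivity)]; exact hpq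
  have hN1 : 1 ≤ N := by rw [hN, one_le_div (by positivity)]; exact hD
  have hX : w * p * D / q ^ 7 = N * S := by rw [hS, hN]; field_simp
  have hkN : (k : ℝ) ≤ 324 * N := by
    rw [stepRadius_pow_four hp] at hk
    have h1 : 1 / 12 * p ^ 4 * (q ^ 2 / (3 * p ^ 2)) ^ 3 = q ^ 6 / (324 * p ^ 2) := by
      field_simp; norm_num
    rw [h1, ← le_div_iff₀ (by positivity)] at hk
    refine hk.trans_eq ?_
    rw [hN]; field_simp
  have hk1 : (k : ℝ) + 1 ≤ 325 * N := by linarith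
  rw [hX, ← hN]
  refine ⟨?_, by push_cast; linarith⟩
  set X := N * S with hXdef
  have hNX : N ≤ X := le_mul_of_one_le_right (by linarith) hS1
  have hSX : S ≤ X := le_mul_of_one_le_left (by linarith) hN1
  have hX1 : 1 ≤ X := hN1.trans hNX
  have hlX : 0 ≤ Real.log X := Real.log_nonneg hX1
  have hlS : Real.log S ≤ Real.log X := Real.log_le_log (by linarith) hSX
  have hd' : (1 : ℝ) ≤ d := by exact_mod_cast hd
  set ℓ := Real.log (d / δ ^ 2) with hℓ
  have hℓ0 : 0 ≤ ℓ := by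
    apply Real.log_nonneg
    rw [one_le_div (by positivity)]
    exact (pow_le_one₀ hδ.le hδ1).trans hd'
  set Λ := 1 + ℓ + Real.log X with hΛ
  have hΛ1 : 1 ≤ Λ := by linarith
  -- The confidences shrink like `1/(j + 1)²`, which costs only `log (j + 1) ≤ log (325 X)`. The
  -- constant is `18 + 7·(15 + 4·324) = 9195`, and the final one comes from `325·2·9195 + 19 <
  -- 6000000`.
  have hT : ∀ j ∈ Finset.range (k + 1),
      (innerSteps d (p ^ 4) (w ^ 2) (stepRadius (p ^ 4) (q ^ 4)) (callConfidence δ j) : ℝ) ≤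
        9195 * S * Λ := by
    intro j hj
    have hjk : (j : ℝ) ≤ k := by exact_mod_cast Nat.lt_succ_iff.1 (Finset.mem_range.1 hj)
    have hlog := log_callConfidence hd hδ j
    have h1 := Real.log_le_sub_one_of_pos (show (0 : ℝ) < 16 by norm_num)
    have h2 : Real.log ((j : ℝ) + 1) ≤ 324 + Real.log X := by
      calc Real.log ((j : ℝ) + 1) ≤ Real.log (325 * X) :=
            Real.log_le_log (by positivity) (by linarith)
        _ = Real.log 325 + Real.log X := Real.log_mul (by norm_num) (by linarith)
        _ ≤ _ := by
          have := Real.log_le_sub_one_of_pos (show (0 : ℝ) < 325 by norm_num)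
          linarith
    have h3 : 0 ≤ Real.log ((j : ℝ) + 1) := Real.log_nonneg (by linarith [Nat.cast_nonneg (α := ℝ) j])
    have h4 : 0 ≤ Real.log (16 : ℝ) := Real.log_nonneg (by norm_num)
    refine (innerSteps_le hp hq hS hS1 (by rw [hlog]; linarith)).trans ?_
    rw [mul_comm 9195 S, mul_assoc]
    gcongr
    rw [hlog]
    linarith
  have hfin := finalSteps_le hp hq hw hS hS1
  rw [hvpEvals_eq]
  push_cast
  have hsum : ∑ j ∈ Finset.range (k + 1), 2 * (innerSteps d (p ^ 4) (w ^ 2)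
      (stepRadius (p ^ 4) (q ^ 4)) (callConfidence δ j) : ℝ) ≤ (k + 1) * (2 * (9195 * S * Λ)) := by
    refine (Finset.sum_le_card_nsmul _ _ (2 * (9195 * S * Λ)) fun j hj => ?_).trans_eq ?_
    · linarith [hT j hj]
    · simp
  have hSΛ : 0 ≤ S * Λ := by positivity
  have hprod : ((k : ℝ) + 1) * (2 * (9195 * S * Λ)) ≤ 325 * N * (2 * (9195 * S * Λ)) := by
    gcongr
  have hfin2 : S * (19 + 3 * Real.log S) ≤ 19 * (X * Λ) := by
    calc S * (19 + 3 * Real.log S) ≤ S * (19 * Λ) := by gcongr; linarith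
      _ ≤ X * (19 * Λ) := by gcongr
      _ = _ := by ring
  have hXΛ : N * (S * Λ) = X * Λ := by rw [hXdef]; ring
  have hXΛ0 : 0 ≤ X * Λ := by positivity
  nlinarith

end Complexity

end

/-! ### The complexity theorem -/

theorem proposition6p3 :
    ∃ C : ℝ, 0 < C ∧
      ∀ (d : ℕ) (g : EuclideanSpace ℝ (Fin d) → ℝ) (β ρ ε δ : ℝ)
        (y₀ : EuclideanSpace ℝ (Fin d)),
        0 < β → 0 < ρ → SmoothObjective g β ρ → 0 < δ → δ ≤ 1 → 0 < ε →
        ε ≤ min (β ^ 2 / ρ) (ρ ^ (1 / 3 : ℝ) * (g y₀ - ⨅ x, g x) ^ (2 / 3 : ℝ)) →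
        ∀ (Ω : Type*) [MeasurableSpace Ω] (P : Measure Ω) [IsProbabilityMeasure P]
          (U : ℕ → Ω → Metric.sphere (0 : EuclideanSpace ℝ (Fin d)) 1)
          (y : ℕ → Ω → EuclideanSpace ℝ (Fin d)),
          IsMajorizationRun P g β ρ ε δ y₀ U y →
          -- the success event contains a measurable event of probability at least `1 - δ`
          ∃ G : Set Ω, MeasurableSet G ∧ ENNReal.ofReal (1 - δ) ≤ P G ∧
            ∀ ω ∈ G, ∃ k : ℕ, StopsAt g ρ ε (fun j => y j ω) k ∧
              (finalPoints g β ρ ε (y k ω)).Nonempty ∧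
              (∀ z ∈ finalPoints g β ρ ε (y k ω), IsSecondOrderStationary g ρ ε z) ∧
              (hvpEvals g β ρ ε δ (fun j => y j ω) (fun j => U j ω) k : ℝ) ≤
                C * (β ^ (1 / 2 : ℝ) * ρ ^ (1 / 4 : ℝ) * (g y₀ - ⨅ x, g x) / ε ^ (7 / 4 : ℝ)) *
                  (1 + Real.log (d / δ ^ 2) +
                    Real.log (β ^ (1 / 2 : ℝ) * ρ ^ (1 / 4 : ℝ) * (g y₀ - ⨅ x, g x) /
                      ε ^ (7 / 4 : ℝ))) ∧
              -- the number `k + 1` of calls to Solve-CR, and the gradient evaluations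
              ((k + 1 : ℕ) : ℝ) ≤ C * (Real.sqrt ρ * (g y₀ - ⨅ x, g x) / ε ^ (3 / 2 : ℝ)) ∧
              (gradEvals g β ρ ε δ (fun j => y j ω) (fun j => U j ω) k : ℝ) ≤
                C * (Real.sqrt ρ * (g y₀ - ⨅ x, g x) / ε ^ (3 / 2 : ℝ)) := by
  refine ⟨6000000, by norm_num, ?_⟩
  intro d g β ρ ε δ y₀ hβ hρ hg hδ hδ1 hε hmin Ω _ P _ U y hrun
  obtain ⟨G, hG, hGP, hlucky⟩ := exists_lucky_event hg hρ.le hδ hrun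
    (fun k => innerSteps d ρ β (stepRadius ρ ε) (callConfidence δ k))
    (-(1 / 12 * ρ * stepRadius ρ ε ^ 3))
  refine ⟨G, hG, hGP, fun ω hω => ?_⟩
  obtain ⟨k, hend, hk⟩ := exists_stopsAt hg.bddBelow hρ hε (fun j => y j ω)
  obtain ⟨Δ, hΔ, hyΔ⟩ := hrun.step k ω hend.1
  have hconf : 0 < callConfidence δ k := by unfold callConfidence; positivity
  obtain ⟨hne, hall⟩ := finalPoints_of_not_makesProgress hg hβ hρ hε hconf
    (hmin.trans (min_le_left _ _)) (hlucky ω hω k) hΔ (by rw [← hyΔ]; exact hend.2)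
  refine ⟨k, hend, hne, hall, ?_⟩
  -- In dimension 0 the unit sphere is empty, so no direction could be drawn.
  have hd : 0 < d := by
    rcases Nat.eq_zero_or_pos d with rfl | h
    · have h1 : ‖(U 0 ω : EuclideanSpace ℝ (Fin 0))‖ = 1 := by simp
      rw [Subsingleton.elim (U 0 ω : EuclideanSpace ℝ (Fin 0)) 0, norm_zero] at h1
      exact absurd h1 zero_ne_one
    · exact h
  rw [gradEvals_eq]
  simp only [hrun.init] at hk
  have hD0 : 0 ≤ g y₀ - ⨅ x, g x := sub_nonneg.2 (ciInf_le hg.bddBelow y₀)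
  set D := g y₀ - ⨅ x, g x with hD
  -- Passing to roots turns all real exponents into natural powers. The two bounds on `ε` then
  -- become `p q ≤ w` and `q⁶ ≤ p² D`.
  obtain ⟨p, hp, hpρ⟩ : ∃ p : ℝ, 0 < p ∧ ρ = p ^ 4 :=
    ⟨ρ ^ (1 / 4 : ℝ), by positivity, by rw [← Real.rpow_natCast, ← Real.rpow_mul hρ.le]; norm_num⟩
  obtain ⟨q, hq, hqε⟩ : ∃ q : ℝ, 0 < q ∧ ε = q ^ 4 :=
    ⟨ε ^ (1 / 4 : ℝ), by positivity, by rw [← Real.rpow_natCast, ← Real.rpow_mul hε.le]; norm_num⟩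
  obtain ⟨w, hw, hwβ⟩ : ∃ w : ℝ, 0 < w ∧ β = w ^ 2 :=
    ⟨Real.sqrt β, by positivity, (Real.sq_sqrt hβ.le).symm⟩
  subst hpρ hqε hwβ
  have e1 : (w ^ 2) ^ (1 / 2 : ℝ) = w := by
    rw [← Real.rpow_natCast, ← Real.rpow_mul hw.le]; norm_num
  have e2 : (p ^ 4) ^ (1 / 4 : ℝ) = p := by
    rw [← Real.rpow_natCast, ← Real.rpow_mul hp.le]; norm_num
  have e3 : (q ^ 4) ^ (7 / 4 : ℝ) = q ^ 7 := by
    rw [← Real.rpow_natCast, ← Real.rpow_mul hq.le, ← Real.rpow_natCast]; norm_num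
  have e4 : (q ^ 4) ^ (3 / 2 : ℝ) = q ^ 6 := by
    rw [← Real.rpow_natCast, ← Real.rpow_mul hq.le, ← Real.rpow_natCast]; norm_num
  have e5 : Real.sqrt (p ^ 4) = p ^ 2 := by
    rw [show p ^ 4 = (p ^ 2) ^ 2 by ring, Real.sqrt_sq (by positivity)]
  rw [e1, e2, e3, e4, e5]
  have hpq : p * q ≤ w := by
    have h1 := hmin.trans (min_le_left _ _)
    rw [le_div_iff₀ (by positivity)] at h1
    have h2 : (p * q) ^ 4 ≤ w ^ 4 := by linarith
    exact le_of_pow_le_pow_left₀ (by norm_num) hw.le h2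
  have hqD : q ^ 6 ≤ p ^ 2 * D := by
    have h1 := Real.rpow_le_rpow (by positivity) (hmin.trans (min_le_right _ _))
      (show (0 : ℝ) ≤ 3 / 2 by norm_num)
    rw [e4, Real.mul_rpow (by positivity) (by positivity), ← Real.rpow_mul (by positivity),
      ← Real.rpow_mul hD0] at h1
    norm_num at h1
    rwa [← Real.sqrt_eq_rpow, e5] at h1
  obtain ⟨h1, h2⟩ := complexity_bounds hd g hp hq hw hδ hδ1 hpq hqD (fun j => y j ω)
    (fun j => (U j ω : EuclideanSpace ℝ (Fin d))) hk
  exact ⟨h1, h2, h2⟩
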